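/- Let $\Gamma$ be a finitely presented group and let $S$ be a finite generating set of $\Gamma$, with word length $|\cdot|$. Let $\delta_\Gamma$ be the Dehn function of a finite presentation of $\Gamma$, i.e. $\delta_\Gamma(n)$ is the largest area of a word of length at most $n$ representing the identity, where the area of a word is the least number of conjugates of relators and their inverses whose product it is in the free group. Suppose that $\delta_\Gamma \lesssim t^N$ for some real $N>0$, meaning that there is $C>0$ with $\delta_\Gamma(n)\le C\,(Cn+C)^N+Cn+C$ for every integer $n>0$. Let $V$ be a real or complex Banach space on which $\Gamma$ acts by a representation $\rho$ by linear isometries. Let $C^k(\Gamma,V)^\Gamma$ be the space of maps $c:\Gamma^{k+1}\to V$ with $c(gg_0,\dots,gg_k)=\rho(g)c(g_0,\dots,g_k)$, with the topology of pointwise convergence and the usual differential $dc(g_0,\dots,g_{k+1})=\sum_{i=0}^{k+1}(-1)^i c(g_0,\dots,\widehat{g_i},\dots,g_{k+1})$, and for real $R\ge 0$ let $C^k_{\mathrm{pol}\le R}(\Gamma,V)^\Gamma$ be the subspace of those $c$ for which there is a constant $K$ with $\|c(g_0,\dots,g_k)\|\le K(1+|g_0|+\dots+|g_k|)^R$ for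 all $g_0,\dots,g_k \in \Gamma$. Put $$H^2(\Gamma,V)=\ker\big(d|_{C^2(\Gamma,V)^\Gamma}\big)/d\big(C^1(\Gamma,V)^\Gamma\big),$$ $$H^2_{\mathrm{pol}:N+1\to N}(\Gamma,V)=\ker\big(d|_{C^2_{\mathrm{pol}\le N}(\Gamma,V)^\Gamma}\big)\Big/\Big(d\big(C^1_{\mathrm{pol}\le N+1}(\Gamma,V)^\Gamma\big)\cap C^2_{\mathrm{pol}\le N}(\Gamma,V)^\Gamma\Big),$$ with the quotient topologies. Then the comparison map $$H^2_{\mathrm{pol}:N+1\to N}(\Gamma,V)\to H^2(\Gamma,V)$$ induced by the inclusion of cochains is an isomorphism of topological vector spaces (a linear bijection that is a homeomorphism). -/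

import Mathlib

namespace QuantCoh

/-! ### Finite presentations, Dehn functions, comparison of growth -/

/-- A finite presentation of a group `Γ`: finitely many generators, and a finite set of relators
whose normal closure in the free group is the kernel of the map onto `Γ`. -/
structure FinitePresentation (Γ : Type*) [Group Γ] where
  numGens : ℕ
  proj : FreeGroup (Fin numGens) →* Γ
  surjective_proj : Function.Surjective proj
  rels : Set (FreeGroup (Fin numGens))
  finite_rels : rels.Finite
  normalClosure_rels : Subgroup.normalClosure rels = proj.ker

/-- `x` is a conjugate of an element of `R` or of the inverse of an element of `R`. -/
def IsRelatorConjugate {F : Type*} [Group F] (R : Set F) (x : F) : Prop :=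
  ∃ u : F, ∃ r ∈ R, x = u * r * u⁻¹ ∨ x = u * r⁻¹ * u⁻¹

/-- The area of `w`: the least number of conjugates of relators and of their inverses
whose product is `w` (used for `w` in the normal closure of `R`). -/
noncomputable def area {F : Type*} [Group F] (R : Set F) (w : F) : ℕ :=
  sInf {k : ℕ | ∃ l : List F, l.length = k ∧ (∀ x ∈ l, IsRelatorConjugate R x) ∧ l.prod = w}

/-- The Dehn function of a finite presentation: the largest area of a word of length at most `n`
that represents the identity. -/
noncomputable def FinitePresentation.dehn {Γ : Type*} [Group Γ] (P : FinitePresentation Γ)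
    (n : ℕ) : ℕ :=
  sSup {k : ℕ | ∃ w : FreeGroup (Fin P.numGens), w ∈ P.proj.ker ∧ w.norm ≤ n ∧ area P.rels w = k}

/-- The set over which the area is minimised is nonempty for relations of the group. -/
theorem FinitePresentation.area_set_nonempty {Γ : Type*} [Group Γ] (P : FinitePresentation Γ)
    (w : FreeGroup (Fin P.numGens)) (hw : w ∈ P.proj.ker) :
    {k : ℕ | ∃ l : List (FreeGroup (Fin P.numGens)), l.length = k ∧
      (∀ x ∈ l, IsRelatorConjugate P.rels x) ∧ l.prod = w}.Nonempty := by
  suffices h : ∃ l : List (FreeGroup (Fin P.numGens)),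
      (∀ x ∈ l, IsRelatorConjugate P.rels x) ∧ l.prod = w by
    obtain ⟨l, h1, h2⟩ := h
    exact ⟨l.length, l, rfl, h1, h2⟩
  rw [← P.normalClosure_rels] at hw
  unfold Subgroup.normalClosure at hw
  induction hw using Subgroup.closure_induction with
  | mem x hx =>
    obtain ⟨r, hr, hrx⟩ := Group.mem_conjugatesOfSet_iff.1 hx
    obtain ⟨u, hu⟩ := isConj_iff.1 hrx
    exact ⟨[x], by simpa using ⟨u, r, hr, Or.inl hu.symm⟩, by simp⟩
  | one => exact ⟨[], by simp, by simp⟩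
  | mul x y _ _ hx hy =>
    obtain ⟨l, h1, h2⟩ := hx
    obtain ⟨m, h3, h4⟩ := hy
    refine ⟨l ++ m, fun z hz => ?_, by simp [h2, h4]⟩
    rcases List.mem_append.1 hz with h | h
    · exact h1 z h
    · exact h3 z h
  | inv x _ hx =>
    obtain ⟨l, h1, h2⟩ := hx
    refine ⟨(l.map (·⁻¹)).reverse, fun z hz => ?_, by rw [← List.prod_inv_reverse, h2]⟩
    obtain ⟨y, hy, rfl⟩ := List.mem_map.1 (List.mem_reverse.1 hz)
    obtain ⟨u, r, hr, h | h⟩ := h1 y hy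
    · exact ⟨u, r, hr, Or.inr (by rw [h]; group)⟩
    · exact ⟨u, r, hr, Or.inl (by rw [h]; group)⟩

/-- The supremum in the definition of the Dehn function is over a finite set. -/
theorem FinitePresentation.dehn_set_finite {Γ : Type*} [Group Γ] (P : FinitePresentation Γ)
    (n : ℕ) :
    {k : ℕ | ∃ w : FreeGroup (Fin P.numGens), w ∈ P.proj.ker ∧ w.norm ≤ n ∧
      area P.rels w = k}.Finite := by
  have h : {w : FreeGroup (Fin P.numGens) | w.norm ≤ n}.Finite :=
    Set.Finite.of_finite_image
      ((List.finite_length_le (Fin P.numGens × Bool) n).subset (by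
        rintro _ ⟨w, hw, rfl⟩
        exact hw))
      (f := FreeGroup.toWord) FreeGroup.toWord_injective.injOn
  refine (h.image (area P.rels)).subset ?_
  rintro k ⟨w, -, hw, rfl⟩
  exact ⟨w, hw, rfl⟩

/-- The relation `f ≲ g` between growth functions:
`f n ≤ C g(C n + C) + C n + C` for all `n > 0`, for some `C > 0`. -/
def GrowthLE (f : ℕ → ℝ) (g : ℝ → ℝ) : Prop :=
  ∃ C : ℝ, 0 < C ∧ ∀ n : ℕ, 0 < n → f n ≤ C * g (C * n + C) + C * n + C

/-- The word length of `g` with respect to `S ∪ S⁻¹`. -/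
noncomputable def wordLength {Γ : Type*} [Group Γ] (S : Set Γ) (g : Γ) : ℕ :=
  sInf {n : ℕ | ∃ l : List Γ, l.length = n ∧ (∀ x ∈ l, x ∈ S ∨ x⁻¹ ∈ S) ∧ l.prod = g}

/-! ### Cochains and cohomology -/

section Cochains

variable {𝕜 : Type*} [RCLike 𝕜] {Γ : Type*} [Group Γ]
  {V : Type*} [NormedAddCommGroup V] [NormedSpace 𝕜 V]

/-- Homogeneous `k`-cochains `Γ^{k+1} → V`. As `Γ` is discrete, the topology of uniform
convergence on compact sets is that of pointwise convergence, the product topology. -/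
abbrev Cochain (Γ : Type*) (V : Type*) (k : ℕ) : Type _ := (Fin (k + 1) → Γ) → V

/-- The homogeneous coboundary operator
`(d c)(g₀, …, g_{k+1}) = ∑ i, (-1)^i c(g₀, …, ĝ_i, …, g_{k+1})`. -/
def coboundary (𝕜 Γ V : Type*) [RCLike 𝕜] [NormedAddCommGroup V] [NormedSpace 𝕜 V] (k : ℕ) :
    Cochain Γ V k →ₗ[𝕜] Cochain Γ V (k + 1) where
  toFun c g := ∑ i : Fin (k + 2), (-1 : ℤ) ^ (i : ℕ) • c (fun j => g (i.succAbove j))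
  map_add' c c' := by
    funext g
    simp [Finset.sum_add_distrib, smul_add]
  map_smul' a c := by
    funext g
    simp only [Pi.smul_apply, RingHom.id_apply, Finset.smul_sum]
    exact Finset.sum_congr rfl fun i _ => smul_comm _ _ _

/-- The equivariant cochains: `c(g g₀, …, g g_k) = ρ(g) c(g₀, …, g_k)`. -/
def equivariantCochains (ρ : Γ →* (V ≃ₗᵢ[𝕜] V)) (k : ℕ) : Submodule 𝕜 (Cochain Γ V k) where
  carrier := {c | ∀ (g : Γ) (x : Fin (k + 1) → Γ), c (fun i => g * x i) = ρ g (c x)}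
  add_mem' {c c'} hc hc' g x := by
    simp only [Pi.add_apply, map_add]
    rw [hc g x, hc' g x]
  zero_mem' g x := by simp
  smul_mem' a c hc g x := by
    simp only [Pi.smul_apply, map_smul]
    rw [hc g x]

/-- The cochains of polynomial growth at most `N` with respect to the word length of `S`. -/
def polCochains (𝕜 : Type*) {Γ : Type*} (V : Type*) [RCLike 𝕜] [Group Γ] [NormedAddCommGroup V]
    [NormedSpace 𝕜 V] (S : Set Γ) (N : ℝ) (k : ℕ) : Submodule 𝕜 (Cochain Γ V k) where
  carrier := {c | ∃ K : ℝ, ∀ x : Fin (k + 1) → Γ,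
    ‖c x‖ ≤ K * (1 + ∑ i, (wordLength S (x i) : ℝ)) ^ N}
  add_mem' {c c'} := by
    rintro ⟨K, hK⟩ ⟨K', hK'⟩
    refine ⟨K + K', fun x => ?_⟩
    rw [add_mul]
    exact (norm_add_le _ _).trans (add_le_add (hK x) (hK' x))
  zero_mem' := ⟨0, fun x => by simp⟩
  smul_mem' a c := by
    rintro ⟨K, hK⟩
    refine ⟨‖a‖ * K, fun x => ?_⟩
    rw [mul_assoc, Pi.smul_apply, norm_smul]
    exact mul_le_mul_of_nonneg_left (hK x) (norm_nonneg a)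

/-- Equivariant cocycles `Z^k(Γ, V)`, with the topology of pointwise convergence. -/
def cocycles (ρ : Γ →* (V ≃ₗᵢ[𝕜] V)) (k : ℕ) : Submodule 𝕜 (Cochain Γ V k) :=
  equivariantCochains ρ k ⊓ LinearMap.ker (coboundary 𝕜 Γ V k)

/-- Coboundaries `B^k(Γ, V) = d (C^{k-1}(Γ, V)^Γ)`, with `C^{-1} = 0`. -/
def coboundaries (ρ : Γ →* (V ≃ₗᵢ[𝕜] V)) : (k : ℕ) → Submodule 𝕜 (Cochain Γ V k)
  | 0 => ⊥
  | k + 1 => (equivariantCochains ρ k).map (coboundary 𝕜 Γ V k)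

/-- Equivariant cocycles of polynomial growth at most `N`. -/
def polCocycles (ρ : Γ →* (V ≃ₗᵢ[𝕜] V)) (S : Set Γ) (N : ℝ) (k : ℕ) :
    Submodule 𝕜 (Cochain Γ V k) :=
  (equivariantCochains ρ k ⊓ polCochains 𝕜 V S N k) ⊓ LinearMap.ker (coboundary 𝕜 Γ V k)

/-- `d (C_{pol ≤ M}^{k-1}(Γ, V)^Γ) ∩ C_{pol ≤ N}^k(Γ, V)^Γ`, with `C^{-1} = 0`. -/
def polCoboundaries (ρ : Γ →* (V ≃ₗᵢ[𝕜] V)) (S : Set Γ) (M N : ℝ) :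
    (k : ℕ) → Submodule 𝕜 (Cochain Γ V k)
  | 0 => ⊥
  | k + 1 => (equivariantCochains ρ k ⊓ polCochains 𝕜 V S M k).map (coboundary 𝕜 Γ V k) ⊓
      (equivariantCochains ρ (k + 1) ⊓ polCochains 𝕜 V S N (k + 1))

/-- Group cohomology `H^k(Γ, V) = Z^k / B^k`, with the quotient topology. -/
abbrev Cohomology (ρ : Γ →* (V ≃ₗᵢ[𝕜] V)) (k : ℕ) : Type _ :=
  ↥(cocycles ρ k) ⧸ (coboundaries ρ k).submoduleOf (cocycles ρ k)

/-- Quantitative polynomial cohomology `H^k_{pol : M → N}(Γ, V)`, with the quotient topology. -/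
abbrev PolCohomology (ρ : Γ →* (V ≃ₗᵢ[𝕜] V)) (S : Set Γ) (M N : ℝ) (k : ℕ) : Type _ :=
  ↥(polCocycles ρ S N k) ⧸ (polCoboundaries ρ S M N k).submoduleOf (polCocycles ρ S N k)

theorem polCocycles_le_cocycles (ρ : Γ →* (V ≃ₗᵢ[𝕜] V)) (S : Set Γ) (N : ℝ) (k : ℕ) :
    polCocycles ρ S N k ≤ cocycles ρ k :=
  inf_le_inf_right _ inf_le_left

theorem polCoboundaries_le_coboundaries (ρ : Γ →* (V ≃ₗᵢ[𝕜] V)) (S : Set Γ) (M N : ℝ) :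
    ∀ k : ℕ, polCoboundaries ρ S M N k ≤ coboundaries ρ k
  | 0 => le_rfl
  | _ + 1 => inf_le_left.trans (Submodule.map_mono inf_le_left)

/-- The comparison map `H^k_{pol : M → N}(Γ, V) → H^k(Γ, V)` induced by the inclusion of
cochains. -/
def comparisonMap (ρ : Γ →* (V ≃ₗᵢ[𝕜] V)) (S : Set Γ) (M N : ℝ) (k : ℕ) :
    PolCohomology ρ S M N k →ₗ[𝕜] Cohomology ρ k :=
  Submodule.mapQ _ _ (Submodule.inclusion (polCocycles_le_cocycles ρ S N k))
    fun _ hx => polCoboundaries_le_coboundaries ρ S M N k hx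

end Cochains

end QuantCoh

open QuantCoh

/-! The comparison map is inverted by correcting cocycles. Suppose that a continuous linear operator
h from 2-cochains to 1-cochains sends each cocycle c to an equivariant cochain such that c + d(h c)
has growth at most N. Then c ↦ c + d(h c) does not change the class of c and depends continuously on
c, which gives surjectivity and a continuous inverse. Injectivity needs no correction: if b is
equivariant and db has growth at most N, summing b(1, gs) = b(1, g) + ρ(g) b(1, s) - db(1, g, gs)
along a word shows that b has growth at most N + 1 (`mem_polCochains_of_coboundary`). This is
`exists_comparison_equiv`; what remains is to build h.

For N ≥ 1, h c (x, y) is the sum of c(x, u, v) over the edges (u, v) of a chosen geodesic word from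
x to y. Up to a bounded term, c + d(h c) at (x, y, z) is then the sum of c(x, ·, ·) over the loop
through x, y, z (`cone_add_coboundary`). Such sums are uniformly bounded on relators, hence bounded
by a multiple of the area, and the Dehn function gives growth at most N.

For N ≤ 1 the linear term in the growth relation dominates, so that the Dehn function is only known
to be at most linear, and coning is too weak when N < 1. But the group is then hyperbolic.
Integrating f dh over a loop, for Lipschitz f and h, gives at most a multiple of the area, hence of
the length. If a geodesic strayed by ρ from a quasi-geodesic with the same ends, a bump function f
of height ρ and a distance function h would produce an integral of order ρ² over a loop of length of
order ρ, so ρ is bounded. Stability of geodesics yields slim triangles and the four-point condition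
(`exists_fourPoint`).

In a hyperbolic group every cocycle can be corrected to a bounded one. An equivariant random walk
from y towards x is built so that its first step depends exponentially little on the far part of the
target. Adding the coboundary of the expected sum of c along the walk makes c balanced: triangles
over one step have mean zero. Balanced cocycles are bounded on triangles with a short side, because
two walks merge with positive probability, and on degenerate triangles, by a geometric series. Every
triangle splits at a center into three degenerate ones, so after antisymmetrization the correction
is bounded everywhere (`exists_norm_add_coboundary_le`). -/

namespace QuantCoh

/-! ### Sums of a function of two variables along the paths spelled by words -/

section PathSum

variable {ι : Type*} {Γ : Type*} [Group Γ] {A : Type*} [AddCommGroup A]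

/-- The action of the free group on `A × Γ` from the right: a generator moves the second
coordinate along an edge and adds the value of `α` on that edge to the first. -/
def pathAction (π : FreeGroup ι →* Γ) (α : Γ → Γ → A) :
    FreeGroup ι →* (Equiv.Perm (A × Γ))ᵐᵒᵖ :=
  FreeGroup.lift fun i => MulOpposite.op
    { toFun := fun p => (p.1 + α p.2 (p.2 * π (FreeGroup.of i)), p.2 * π (FreeGroup.of i))
      invFun := fun p =>
        (p.1 - α (p.2 * (π (FreeGroup.of i))⁻¹) p.2, p.2 * (π (FreeGroup.of i))⁻¹)
      left_inv := fun p => by ext <;> simp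
      right_inv := fun p => by ext <;> simp }

/-- The sum of `α` over the edges of the path that starts at `g` and is spelled by `w`. -/
def pathSum (π : FreeGroup ι →* Γ) (α : Γ → Γ → A) (g : Γ) (w : FreeGroup ι) : A :=
  ((pathAction π α w).unop (0, g)).1

theorem pathAction_apply (π : FreeGroup ι →* Γ) (α : Γ → Γ → A) (w : FreeGroup ι) :
    ∀ (v : A) (g : Γ), (pathAction π α w).unop (v, g) = (v + pathSum π α g w, g * π w) := by
  have key : ∀ v g, (pathAction π α w).unop (v, g)
      = (v + ((pathAction π α w).unop (0, g)).1, g * π w) := by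
    induction w using FreeGroup.induction_on with
    | C1 => intro v g; simp
    | of i => intro v g; simp [pathAction]
    | inv_of i ih =>
      intro v g
      simp [pathAction, Equiv.Perm.inv_def, Equiv.symm, sub_eq_add_neg]
    | mul x y hx hy =>
      intro v g
      simp only [map_mul, MulOpposite.unop_mul, Equiv.Perm.mul_apply]
      rw [hx v g, hx 0 g, hy, hy (0 + _)]
      simp [add_assoc, mul_assoc]
  exact key

variable (π : FreeGroup ι →* Γ) (α : Γ → Γ → A)

theorem pathSum_mul (g : Γ) (w w' : FreeGroup ι) :
    pathSum π α g (w * w') = pathSum π α g w + pathSum π α (g * π w) w' := by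
  have h : (pathAction π α (w * w')).unop (0, g)
      = (pathAction π α w').unop ((pathAction π α w).unop (0, g)) := by
    simp [map_mul]
  unfold pathSum
  rw [h, pathAction_apply π α w, pathAction_apply]
  simp [pathSum]

@[simp] theorem pathSum_one (g : Γ) : pathSum π α g 1 = 0 := by
  simp [pathSum]

@[simp] theorem pathSum_of (g : Γ) (i : ι) :
    pathSum π α g (FreeGroup.of i) = α g (g * π (FreeGroup.of i)) := by
  simp [pathSum, pathAction]

/-- A backward letter subtracts the value on the forward edge, so paths cancel against their
reverses for every `α`, antisymmetric or not. -/
theorem pathSum_inv (g : Γ) (w : FreeGroup ι) :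
    pathSum π α g w⁻¹ = - pathSum π α (g * (π w)⁻¹) w := by
  have h := pathSum_mul π α g w⁻¹ w
  rw [inv_mul_cancel, pathSum_one, map_inv] at h
  exact eq_neg_of_add_eq_zero_left h.symm

/-- An induction principle for words, letter by letter from the left. -/
theorem FreeGroup_induction_word [DecidableEq ι] {C : FreeGroup ι → ℕ → Prop} (h1 : C 1 0)
    (hc : ∀ (i : ι) (w : FreeGroup ι) (n : ℕ), C w n →
      C (FreeGroup.of i * w) (n + 1) ∧ C ((FreeGroup.of i)⁻¹ * w) (n + 1))
    (w : FreeGroup ι) : C w w.norm := by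
  have key : ∀ L : List (ι × Bool), C (FreeGroup.mk L) L.length := by
    intro L
    induction L with
    | nil => exact h1
    | cons a L ih =>
      obtain ⟨i, b⟩ := a
      have h : FreeGroup.mk ((i, b) :: L) = FreeGroup.mk [(i, b)] * FreeGroup.mk L := by
        rw [FreeGroup.mul_mk]; rfl
      rw [h, List.length_cons]
      cases b
      · have : FreeGroup.mk [(i, false)] = (FreeGroup.of i)⁻¹ := by
          simp [FreeGroup.of, FreeGroup.inv_mk, FreeGroup.invRev]
        rw [this]
        exact (hc i _ _ ih).2
      · exact (hc i _ _ ih).1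
  have := key w.toWord
  rwa [FreeGroup.mk_toWord] at this

end PathSum

section PathSumNorm

variable {ι : Type*} {Γ : Type*} [Group Γ] {A : Type*} [SeminormedAddCommGroup A]

/-- In a conjugate of a relator the way out and the way back cancel, leaving the sum over the
relator from a shifted starting point. Relator conjugates are closed loops, so in a product of them
each factor starts again at `g`. -/
theorem norm_pathSum_le_area (π : FreeGroup ι →* Γ) (α : Γ → Γ → A) (R : Set (FreeGroup ι))
    (hR : ∀ r ∈ R, π r = 1) {M : ℝ} (hM : ∀ g, ∀ r ∈ R, ‖pathSum π α g r‖ ≤ M)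
    (w : FreeGroup ι)
    (hw : {k : ℕ | ∃ l : List (FreeGroup ι), l.length = k ∧
      (∀ x ∈ l, IsRelatorConjugate R x) ∧ l.prod = w}.Nonempty) (g : Γ) :
    ‖pathSum π α g w‖ ≤ M * area R w := by
  have hconj : ∀ x, IsRelatorConjugate R x → π x = 1 ∧ ∀ g, ‖pathSum π α g x‖ ≤ M := by
    rintro x ⟨u, r, hr, rfl | rfl⟩
    · refine ⟨by simp [hR r hr], fun g => ?_⟩
      rw [pathSum_mul, pathSum_mul, pathSum_inv]
      simpa [hR r hr] using hM (g * π u) r hr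
    · refine ⟨by simp [hR r hr], fun g => ?_⟩
      rw [pathSum_mul, pathSum_mul, pathSum_inv, pathSum_inv]
      simpa [hR r hr] using hM (g * π u) r hr
  have hlist : ∀ l : List (FreeGroup ι), (∀ x ∈ l, IsRelatorConjugate R x) →
      ∀ g, ‖pathSum π α g l.prod‖ ≤ M * l.length := by
    intro l
    induction l with
    | nil => intro _ g; simp
    | cons x l ih =>
      intro h g
      have hx := hconj x (h x (by simp))
      rw [List.prod_cons, pathSum_mul, hx.1, mul_one, List.length_cons]
      calc _ ≤ ‖pathSum π α g x‖ + ‖pathSum π α g l.prod‖ := norm_add_le _ _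
        _ ≤ M + M * l.length := add_le_add (hx.2 g) (ih (fun y hy => h y (by simp [hy])) g)
        _ = _ := by push_cast; ring
  obtain ⟨l, hl, hl', rfl⟩ := Nat.sInf_mem hw
  have := hlist l hl' g
  rwa [hl] at this

end PathSumNorm

/-! ### Graph metrics and the word metric of a presentation -/

/-- The properties of the path metric of a connected graph. -/
structure IsGraphMetric {X : Type*} (d : X → X → ℕ) : Prop where
  self : ∀ x, d x x = 0
  eq_of : ∀ x y, d x y = 0 → x = y
  symm : ∀ x y, d x y = d y x
  tri : ∀ x y z, d x z ≤ d x y + d y z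
  between : ∀ x y k, k ≤ d x y → ∃ u, d x u = k ∧ d x u + d u y = d x y

namespace FinitePresentation

variable {Γ : Type*} [Group Γ] (P : FinitePresentation Γ)

theorem proj_eq_one_of_mem_rels {r : FreeGroup (Fin P.numGens)} (hr : r ∈ P.rels) :
    P.proj r = 1 := by
  have h : r ∈ Subgroup.normalClosure P.rels := Subgroup.subset_normalClosure hr
  rwa [P.normalClosure_rels] at h

theorem area_le_dehn {w : FreeGroup (Fin P.numGens)} (hw : P.proj w = 1) {n : ℕ}
    (hn : w.norm ≤ n) : area P.rels w ≤ P.dehn n :=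
  le_csSup (P.dehn_set_finite n).bddAbove ⟨w, hw, hn, rfl⟩

theorem exists_norm_pathSum_le {A : Type*} [SeminormedAddCommGroup A] (α : Γ → Γ → A) {M : ℝ}
    (hM0 : 0 ≤ M) (hM : ∀ g, ∀ r ∈ P.rels, ‖pathSum P.proj α g r‖ ≤ M)
    {w : FreeGroup (Fin P.numGens)} (hw : P.proj w = 1) {n : ℕ} (hn : w.norm ≤ n) (g : Γ) :
    ‖pathSum P.proj α g w‖ ≤ M * P.dehn n :=
  (norm_pathSum_le_area P.proj α P.rels (fun _ hr => P.proj_eq_one_of_mem_rels hr) hM w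
    (P.area_set_nonempty w hw) g).trans
    (mul_le_mul_of_nonneg_left (by exact_mod_cast P.area_le_dehn hw hn) hM0)

/-- The word length of an element with respect to the generators of a presentation. -/
noncomputable def len (g : Γ) : ℕ := sInf {n | ∃ w, P.proj w = g ∧ w.norm = n}

theorem exists_geodesic (g : Γ) : ∃ w, P.proj w = g ∧ w.norm = P.len g := by
  obtain ⟨w, hw⟩ := P.surjective_proj g
  exact Nat.sInf_mem (s := {n | ∃ w, P.proj w = g ∧ w.norm = n}) ⟨_, w, hw, rfl⟩

theorem len_proj_le (w : FreeGroup (Fin P.numGens)) : P.len (P.proj w) ≤ w.norm :=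
  Nat.sInf_le ⟨w, rfl, rfl⟩

/-- A geodesic word representing a group element. -/
noncomputable def word (g : Γ) : FreeGroup (Fin P.numGens) := (P.exists_geodesic g).choose

@[simp] theorem proj_word (g : Γ) : P.proj (P.word g) = g := (P.exists_geodesic g).choose_spec.1

theorem norm_word (g : Γ) : (P.word g).norm = P.len g := (P.exists_geodesic g).choose_spec.2

theorem len_one : P.len 1 = 0 := by
  have := P.len_proj_le 1
  simpa using this

theorem eq_one_of_len {g : Γ} (h : P.len g = 0) : g = 1 := by
  rw [← P.norm_word, FreeGroup.norm_eq_zero] at h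
  rw [← P.proj_word g, h, map_one]

theorem len_mul_le (g h : Γ) : P.len (g * h) ≤ P.len g + P.len h := by
  have := P.len_proj_le (P.word g * P.word h)
  rw [map_mul, proj_word, proj_word] at this
  refine this.trans ((FreeGroup.norm_mul_le _ _).trans ?_)
  rw [norm_word, norm_word]

theorem len_inv (g : Γ) : P.len g⁻¹ = P.len g := by
  have h : ∀ g, P.len g⁻¹ ≤ P.len g := fun g => by
    have := P.len_proj_le (P.word g)⁻¹
    rwa [map_inv, proj_word, FreeGroup.norm_inv_eq, norm_word] at this
  exact le_antisymm (h g) (by simpa using h g⁻¹)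

theorem exists_len_split (g : Γ) {k : ℕ} (hk : k ≤ P.len g) :
    ∃ h, P.len h = k ∧ P.len h + P.len (h⁻¹ * g) = P.len g := by
  set L := (P.word g).toWord
  have hL : L.length = P.len g := P.norm_word g
  have hg : P.proj (FreeGroup.mk (L.take k)) * P.proj (FreeGroup.mk (L.drop k)) = g := by
    rw [← map_mul, FreeGroup.mul_mk, List.take_append_drop, FreeGroup.mk_toWord, proj_word]
  refine ⟨P.proj (FreeGroup.mk (L.take k)), ?_⟩
  have h1 : P.len (P.proj (FreeGroup.mk (L.take k))) ≤ k :=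
    (P.len_proj_le _).trans (FreeGroup.norm_mk_le.trans (by simp))
  have h2 : P.len (P.proj (FreeGroup.mk (L.drop k))) ≤ P.len g - k :=
    (P.len_proj_le _).trans (FreeGroup.norm_mk_le.trans (by simp [hL]))
  have h3 : (P.proj (FreeGroup.mk (L.take k)))⁻¹ * g = P.proj (FreeGroup.mk (L.drop k)) := by
    rw [inv_mul_eq_iff_eq_mul, hg]
  have h4 := P.len_mul_le (P.proj (FreeGroup.mk (L.take k))) (P.proj (FreeGroup.mk (L.drop k)))
  rw [hg] at h4
  rw [h3]
  omega

/-- The word metric. -/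
noncomputable def dist (x y : Γ) : ℕ := P.len (x⁻¹ * y)

theorem isGraphMetric_dist : IsGraphMetric P.dist where
  self x := by simp [dist, len_one]
  eq_of x y h := by
    have := P.eq_one_of_len h
    rwa [inv_mul_eq_one] at this
  symm x y := by
    rw [dist, dist, ← len_inv]; simp
  tri x y z := by
    have := P.len_mul_le (x⁻¹ * y) (y⁻¹ * z)
    simpa [dist, mul_assoc] using this
  between x y k hk := by
    obtain ⟨h, h1, h2⟩ := P.exists_len_split _ hk
    exact ⟨x * h, by simpa [dist] using h1, by simpa [dist, mul_assoc] using h2⟩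

theorem dist_mul_left (g x y : Γ) : P.dist (g * x) (g * y) = P.dist x y := by
  simp [dist, mul_assoc]

theorem finite_ball (x : Γ) (n : ℕ) : {y | P.dist x y ≤ n}.Finite := by
  have h : {w : FreeGroup (Fin P.numGens) | w.norm ≤ n}.Finite :=
    Set.Finite.of_finite_image
      ((List.finite_length_le (Fin P.numGens × Bool) n).subset (by
        rintro _ ⟨w, hw, rfl⟩
        exact hw))
      (f := FreeGroup.toWord) FreeGroup.toWord_injective.injOn
  refine (h.image fun w => x * P.proj w).subset fun y hy => ⟨P.word (x⁻¹ * y), ?_, by simp⟩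
  rw [Set.mem_ofPred_eq, norm_word]
  exact hy

end FinitePresentation

/-! ### Word length of a generating set -/

section WordLength

variable {Γ : Type*} [Group Γ] {S : Set Γ}

theorem wordLength_set_nonempty (hS : Subgroup.closure S = ⊤) (g : Γ) :
    {n : ℕ | ∃ l : List Γ, l.length = n ∧ (∀ x ∈ l, x ∈ S ∨ x⁻¹ ∈ S) ∧ l.prod = g}.Nonempty := by
  have hg : g ∈ Subgroup.closure S := by rw [hS]; trivial
  rw [← Subgroup.mem_toSubmonoid, Subgroup.closure_toSubmonoid] at hg
  obtain ⟨l, hl, hg⟩ := Submonoid.exists_list_of_mem_closure hg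
  exact ⟨_, l, rfl, hl, hg⟩

theorem exists_list_wordLength (hS : Subgroup.closure S = ⊤) (g : Γ) :
    ∃ l : List Γ, l.length = wordLength S g ∧ (∀ x ∈ l, x ∈ S ∨ x⁻¹ ∈ S) ∧ l.prod = g :=
  Nat.sInf_mem (wordLength_set_nonempty hS g)

theorem wordLength_prod_le {l : List Γ} (hl : ∀ x ∈ l, x ∈ S ∨ x⁻¹ ∈ S) :
    wordLength S l.prod ≤ l.length :=
  Nat.sInf_le ⟨l, rfl, hl, rfl⟩

theorem wordLength_mul_le (hS : Subgroup.closure S = ⊤) (g h : Γ) :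
    wordLength S (g * h) ≤ wordLength S g + wordLength S h := by
  obtain ⟨l, hl, hl', rfl⟩ := exists_list_wordLength hS g
  obtain ⟨m, hm, hm', rfl⟩ := exists_list_wordLength hS h
  rw [← hl, ← hm, ← List.length_append, ← List.prod_append]
  refine wordLength_prod_le fun x hx => ?_
  rcases List.mem_append.1 hx with h | h
  exacts [hl' x h, hm' x h]

theorem wordLength_inv_le (hS : Subgroup.closure S = ⊤) (g : Γ) :
    wordLength S g⁻¹ ≤ wordLength S g := by
  obtain ⟨l, hl, hl', rfl⟩ := exists_list_wordLength hS g
  rw [← hl, List.prod_inv_reverse]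
  refine (wordLength_prod_le fun x hx => ?_).trans (by simp)
  obtain ⟨y, hy, rfl⟩ := List.mem_map.1 (List.mem_reverse.1 hx)
  rw [inv_inv]
  exact (hl' y hy).symm

/-- A length function is at most linear in any word length of a finite generating set. -/
theorem exists_len_le_wordLength (hS : Subgroup.closure S = ⊤) (hSf : S.Finite)
    (P : FinitePresentation Γ) : ∃ D : ℕ, ∀ g, P.len g ≤ D * wordLength S g := by
  obtain ⟨D, hD⟩ := (hSf.image P.len).bddAbove
  refine ⟨D, fun g => ?_⟩
  have key : ∀ l : List Γ, (∀ x ∈ l, x ∈ S ∨ x⁻¹ ∈ S) → P.len l.prod ≤ D * l.length := by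
    intro l
    induction l with
    | nil => intro _; simp [P.len_one]
    | cons x l ih =>
      intro h
      have hx : P.len x ≤ D := by
        rcases h x (by simp) with hx | hx
        · exact hD ⟨x, hx, rfl⟩
        · rw [← P.len_inv]
          exact hD ⟨_, hx, rfl⟩
      have := ih fun y hy => h y (by simp [hy])
      rw [List.prod_cons, List.length_cons, mul_add, mul_one]
      exact (P.len_mul_le _ _).trans (by omega)
  obtain ⟨l, hl, hl', rfl⟩ := exists_list_wordLength hS g
  rw [← hl]
  exact key l hl'

end WordLength

/-! ### Cochains of low degree -/

section CoboundaryFormulas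

variable {𝕜 : Type*} [RCLike 𝕜] {Γ : Type*}
  {V : Type*} [NormedAddCommGroup V] [NormedSpace 𝕜 V]

theorem coboundary_one_apply (b : Cochain Γ V 1) (x y z : Γ) :
    coboundary 𝕜 Γ V 1 b ![x, y, z] = b ![y, z] - b ![x, z] + b ![x, y] := by
  have h0 : (fun j => (![x, y, z] : Fin 3 → Γ) ((0 : Fin 3).succAbove j)) = ![y, z] := by
    ext j; fin_cases j <;> rfl
  have h1 : (fun j => (![x, y, z] : Fin 3 → Γ) ((1 : Fin 3).succAbove j)) = ![x, z] := by
    ext j; fin_cases j <;> rfl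
  have h2 : (fun j => (![x, y, z] : Fin 3 → Γ) ((2 : Fin 3).succAbove j)) = ![x, y] := by
    ext j; fin_cases j <;> rfl
  change ∑ i : Fin 3, (-1 : ℤ) ^ (i : ℕ) • b (fun j => ![x, y, z] (i.succAbove j)) = _
  rw [Fin.sum_univ_three, h0, h1, h2]
  simp [sub_eq_add_neg]

theorem coboundary_two_apply (c : Cochain Γ V 2) (x y z t : Γ) :
    coboundary 𝕜 Γ V 2 c ![x, y, z, t]
      = c ![y, z, t] - c ![x, z, t] + c ![x, y, t] - c ![x, y, z] := by
  have h0 : (fun j => (![x, y, z, t] : Fin 4 → Γ) ((0 : Fin 4).succAbove j)) = ![y, z, t] := by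
    ext j; fin_cases j <;> rfl
  have h1 : (fun j => (![x, y, z, t] : Fin 4 → Γ) ((1 : Fin 4).succAbove j)) = ![x, z, t] := by
    ext j; fin_cases j <;> rfl
  have h2 : (fun j => (![x, y, z, t] : Fin 4 → Γ) ((2 : Fin 4).succAbove j)) = ![x, y, t] := by
    ext j; fin_cases j <;> rfl
  have h3 : (fun j => (![x, y, z, t] : Fin 4 → Γ) ((3 : Fin 4).succAbove j)) = ![x, y, z] := by
    ext j; fin_cases j <;> rfl
  change ∑ i : Fin 4, (-1 : ℤ) ^ (i : ℕ) • c (fun j => ![x, y, z, t] (i.succAbove j)) = _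
  rw [Fin.sum_univ_four, h0, h1, h2, h3]
  simp [sub_eq_add_neg, pow_succ]

theorem vec_two_eta (x : Fin 2 → Γ) : ![x 0, x 1] = x := by
  ext i; fin_cases i <;> rfl

theorem vec_three_eta (x : Fin 3 → Γ) : ![x 0, x 1, x 2] = x := by
  ext i; fin_cases i <;> rfl

theorem coboundary_coboundary (b : Cochain Γ V 1) :
    coboundary 𝕜 Γ V 2 (coboundary 𝕜 Γ V 1 b) = 0 := by
  funext x
  have hx : ![x 0, x 1, x 2, x 3] = x := by ext i; fin_cases i <;> rfl
  rw [← hx, coboundary_two_apply]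
  simp only [coboundary_one_apply, Pi.zero_apply]
  abel

theorem continuous_coboundary (k : ℕ) : Continuous (coboundary 𝕜 Γ V k) := by
  refine continuous_pi fun x => ?_
  change Continuous fun c : Cochain Γ V k =>
    ∑ i : Fin (k + 2), (-1 : ℤ) ^ (i : ℕ) • c (fun j => x (i.succAbove j))
  refine continuous_finsetSum _ fun i _ => ?_
  exact (continuous_apply (fun j => x (i.succAbove j))).const_smul ((-1 : ℤ) ^ (i : ℕ))

end CoboundaryFormulas

section Cochains

variable {𝕜 : Type*} [RCLike 𝕜] {Γ : Type*} [Group Γ]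
  {V : Type*} [NormedAddCommGroup V] [NormedSpace 𝕜 V]

theorem coboundary_mem_equivariantCochains (ρ : Γ →* (V ≃ₗᵢ[𝕜] V)) {k : ℕ} {b : Cochain Γ V k}
    (hb : b ∈ equivariantCochains ρ k) :
    coboundary 𝕜 Γ V k b ∈ equivariantCochains ρ (k + 1) := by
  intro g x
  change ∑ i : Fin (k + 2), (-1 : ℤ) ^ (i : ℕ) • b (fun j => g * x (i.succAbove j))
    = ρ g (∑ i : Fin (k + 2), (-1 : ℤ) ^ (i : ℕ) • b (fun j => x (i.succAbove j)))
  rw [map_sum]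
  refine Finset.sum_congr rfl fun i _ => ?_
  rw [map_zsmul, ← hb g]

theorem mem_cocycles_two_iff (ρ : Γ →* (V ≃ₗᵢ[𝕜] V)) (c : Cochain Γ V 2) :
    c ∈ cocycles ρ 2 ↔ (∀ g x y z, c ![g * x, g * y, g * z] = ρ g (c ![x, y, z])) ∧
      ∀ x y z t, c ![y, z, t] - c ![x, z, t] + c ![x, y, t] - c ![x, y, z] = 0 := by
  constructor
  · rintro ⟨h1, h2⟩
    refine ⟨fun g x y z => ?_, fun x y z t => ?_⟩
    · rw [← h1 g]
      congr 1
      ext i; fin_cases i <;> rfl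
    · rw [← coboundary_two_apply (𝕜 := 𝕜), LinearMap.mem_ker.1 h2]
      rfl
  · rintro ⟨h1, h2⟩
    refine ⟨fun g x => ?_, LinearMap.mem_ker.2 (funext fun x => ?_)⟩
    · rw [← vec_three_eta x, ← h1 g]
      congr 1
      ext i; fin_cases i <;> rfl
    · have hx : ![x 0, x 1, x 2, x 3] = x := by ext i; fin_cases i <;> rfl
      rw [← hx, coboundary_two_apply, h2]
      rfl

theorem mem_equivariantCochains_one_iff (ρ : Γ →* (V ≃ₗᵢ[𝕜] V)) (b : Cochain Γ V 1) :
    b ∈ equivariantCochains ρ 1 ↔ ∀ g x y, b ![g * x, g * y] = ρ g (b ![x, y]) := by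
  constructor
  · intro h g x y
    rw [← h g]
    congr 1
    ext i; fin_cases i <;> rfl
  · intro h g x
    rw [← vec_two_eta x, ← h g]
    congr 1
    ext i; fin_cases i <;> rfl

/-- An equivariant `1`-cochain whose coboundary has polynomial growth at most `N` has itself
polynomial growth at most `N + 1`. -/
theorem mem_polCochains_of_coboundary (ρ : Γ →* (V ≃ₗᵢ[𝕜] V)) {S : Set Γ} (hSf : S.Finite)
    (hS : Subgroup.closure S = ⊤) {N : ℝ} (hN : 0 ≤ N) {b : Cochain Γ V 1}
    (hb : b ∈ equivariantCochains ρ 1) (hdb : coboundary 𝕜 Γ V 1 b ∈ polCochains 𝕜 V S N 2) :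
    b ∈ polCochains 𝕜 V S (N + 1) 1 := by
  obtain ⟨K, hK⟩ := hdb
  rw [mem_equivariantCochains_one_iff] at hb
  obtain ⟨M, hM⟩ := ((hSf.union hSf.inv).image fun s => ‖b ![1, s]‖).bddAbove
  set M' := |M|
  have hM' : ∀ s, s ∈ S ∨ s⁻¹ ∈ S → ‖b ![1, s]‖ ≤ M' := fun s hs =>
    (hM ⟨s, by simpa using hs, rfl⟩).trans (le_abs_self M)
  have hw1 : wordLength S (1 : Γ) = 0 :=
    Nat.le_zero.1 (wordLength_prod_le (S := S) (l := []) (by simp))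
  -- Induction on the last letter: appending s to the word of g costs ‖b(1, s)‖, by equivariance,
  -- plus the norm of db(1, g, gs).
  have step : ∀ l : List Γ, (∀ x ∈ l, x ∈ S ∨ x⁻¹ ∈ S) →
      ‖b ![1, l.prod]‖ ≤ ‖b ![1, 1]‖ + l.length * (M' + |K| * (1 + 2 * l.length) ^ N) := by
    intro l
    induction l using List.reverseRecOn with
    | nil => intro _; simp
    | append_singleton l s ih =>
      intro h
      have hl : ∀ x ∈ l, x ∈ S ∨ x⁻¹ ∈ S := fun x hx => h x (by simp [hx])
      have h1 := ih hl
      have h2 := hK ![1, l.prod, (l ++ [s]).prod]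
      rw [coboundary_one_apply] at h2
      have h3 : b ![l.prod, (l ++ [s]).prod] = ρ l.prod (b ![1, s]) := by
        rw [← hb]; simp
      have h4 : ‖b ![l.prod, (l ++ [s]).prod]‖ ≤ M' := by
        rw [h3, LinearIsometryEquiv.norm_map]
        exact hM' s (h s (by simp))
      have h5 : (wordLength S l.prod : ℝ) ≤ l.length := by exact_mod_cast wordLength_prod_le hl
      have h6 : (wordLength S (l ++ [s]).prod : ℝ) ≤ l.length + 1 := by
        have := wordLength_prod_le h
        rw [List.length_append, List.length_singleton] at this
        exact_mod_cast this
      have h7 : K * (1 + ∑ i, (wordLength S ((![1, l.prod, (l ++ [s]).prod] : Fin 3 → Γ) i) : ℝ))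
          ^ N ≤ |K| * (1 + 2 * (l.length + 1 : ℝ)) ^ N := by
        refine mul_le_mul (le_abs_self K) (Real.rpow_le_rpow (by positivity) ?_ hN)
          (by positivity) (abs_nonneg K)
        rw [Fin.sum_univ_three]
        simp only [Matrix.cons_val_zero, Matrix.cons_val_one, Matrix.cons_val_two, hw1]
        change 1 + (((0 : ℕ) : ℝ) + (wordLength S l.prod : ℝ) + (wordLength S (l ++ [s]).prod : ℝ))
          ≤ _
        push_cast
        linarith
      have h8 : (1 + 2 * (l.length : ℝ)) ^ N ≤ (1 + 2 * (l.length + 1 : ℝ)) ^ N :=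
        Real.rpow_le_rpow (by positivity) (by linarith) hN
      have h9 : ‖b ![1, (l ++ [s]).prod]‖ ≤ ‖b ![1, l.prod]‖ + M' +
          |K| * (1 + 2 * (l.length + 1 : ℝ)) ^ N := by
        have : b ![1, (l ++ [s]).prod] = b ![1, l.prod] + b ![l.prod, (l ++ [s]).prod]
            - (b ![l.prod, (l ++ [s]).prod] - b ![1, (l ++ [s]).prod] + b ![1, l.prod]) := by abel
        rw [this]
        refine (norm_sub_le _ _).trans (add_le_add ((norm_add_le _ _).trans ?_) (h2.trans h7))
        exact add_le_add le_rfl h4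
      have h10 : (l.length : ℝ) * (M' + |K| * (1 + 2 * l.length) ^ N)
          ≤ l.length * (M' + |K| * (1 + 2 * (l.length + 1 : ℝ)) ^ N) :=
        mul_le_mul_of_nonneg_left (by gcongr) (by positivity)
      rw [List.length_append, List.length_singleton]
      push_cast
      linarith
  refine ⟨(‖b ![1, 1]‖ + M' + |K| * 2 ^ N), fun x => ?_⟩
  rw [Fin.sum_univ_two]
  set t : ℝ := (wordLength S (x 0) : ℝ) + wordLength S (x 1)
  have ht : 0 ≤ t := by positivity
  have h1 : ‖b x‖ = ‖b ![1, (x 0)⁻¹ * x 1]‖ := by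
    have := hb (x 0) 1 ((x 0)⁻¹ * x 1)
    rw [mul_one, mul_inv_cancel_left, vec_two_eta] at this
    rw [this, LinearIsometryEquiv.norm_map]
  obtain ⟨l, hl, hl', hl''⟩ := exists_list_wordLength hS ((x 0)⁻¹ * x 1)
  have h2 := step l hl'
  rw [hl'', ← h1] at h2
  have h3 : (l.length : ℝ) ≤ t := by
    rw [hl]
    have := (wordLength_mul_le hS (x 0)⁻¹ (x 1)).trans
      (Nat.add_le_add_right (wordLength_inv_le hS (x 0)) _)
    simp only [t]
    exact_mod_cast this
  have h4 : (1 + 2 * (l.length : ℝ)) ^ N ≤ 2 ^ N * (1 + t) ^ N := by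
    rw [← Real.mul_rpow (by norm_num) (by positivity)]
    exact Real.rpow_le_rpow (by positivity) (by linarith) hN
  have h5 : 1 ≤ (1 + t) ^ N := Real.one_le_rpow (by linarith) hN
  have h6 : (1 + t) ^ (N + 1) = (1 + t) * (1 + t) ^ N := by
    rw [Real.rpow_add (by positivity), Real.rpow_one, mul_comm]
  have h7 : (l.length : ℝ) * (M' + |K| * (1 + 2 * l.length) ^ N)
      ≤ t * (M' * (1 + t) ^ N + |K| * (2 ^ N * (1 + t) ^ N)) := by
    refine mul_le_mul h3 (add_le_add ?_ (mul_le_mul_of_nonneg_left h4 (abs_nonneg K)))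
      (by positivity) ht
    exact le_mul_of_one_le_right (abs_nonneg M) h5
  have h8 : ‖b ![1, 1]‖ ≤ ‖b ![1, 1]‖ * ((1 + t) * (1 + t) ^ N) :=
    le_mul_of_one_le_right (norm_nonneg _) (one_le_mul_of_one_le_of_one_le (by linarith) h5)
  rw [h6]
  have h9 : t * (M' * (1 + t) ^ N + |K| * (2 ^ N * (1 + t) ^ N))
      ≤ (1 + t) * (M' * (1 + t) ^ N + |K| * (2 ^ N * (1 + t) ^ N)) :=
    mul_le_mul_of_nonneg_right (by linarith) (by positivity)
  calc ‖b x‖ ≤ _ := h2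
    _ ≤ ‖b ![1, 1]‖ * ((1 + t) * (1 + t) ^ N)
        + (1 + t) * (M' * (1 + t) ^ N + |K| * (2 ^ N * (1 + t) ^ N)) := by linarith
    _ = _ := by ring

/-- If cocycles can be corrected, linearly and continuously, by coboundaries of equivariant
cochains to have polynomial growth at most `N`, then the comparison map is an isomorphism of
topological vector spaces. -/
theorem exists_comparison_equiv (ρ : Γ →* (V ≃ₗᵢ[𝕜] V)) {S : Set Γ} (hSf : S.Finite)
    (hS : Subgroup.closure S = ⊤) {N : ℝ} (hN : 0 ≤ N)
    (h : Cochain Γ V 2 →L[𝕜] Cochain Γ V 1)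
    (heq : ∀ c ∈ cocycles ρ 2, h c ∈ equivariantCochains ρ 1)
    (hpol : ∀ c ∈ cocycles ρ 2, c + coboundary 𝕜 Γ V 1 (h c) ∈ polCochains 𝕜 V S N 2) :
    ∃ e : PolCohomology ρ S (N + 1) N 2 ≃L[𝕜] Cohomology ρ 2,
      ∀ x, e x = comparisonMap ρ S (N + 1) N 2 x := by
  -- The correction 1 + dh acts as the identity on cohomology, and its image on cocycles has growth
  -- at most `N`; it induces the inverse.
  let t : Cochain Γ V 2 →ₗ[𝕜] Cochain Γ V 2 :=
    LinearMap.id + (coboundary 𝕜 Γ V 1).comp h.toLinearMap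
  have ht : ∀ c, t c = c + coboundary 𝕜 Γ V 1 (h c) := fun c => rfl
  have hmem : ∀ c : cocycles ρ 2, t c ∈ polCocycles ρ S N 2 := fun c =>
    ⟨⟨Submodule.add_mem _ c.2.1 (coboundary_mem_equivariantCochains ρ (heq c c.2)),
      hpol c c.2⟩, LinearMap.mem_ker.2 (by
        have hc := LinearMap.mem_ker.1 c.2.2
        rw [ht, map_add, coboundary_coboundary, hc, add_zero])⟩
  let s : cocycles ρ 2 →ₗ[𝕜] polCocycles ρ S N 2 :=
    LinearMap.codRestrict _ (t.comp (cocycles ρ 2).subtype) hmem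
  have hs : ∀ c, ((s c : polCocycles ρ S N 2) : Cochain Γ V 2)
      = c + coboundary 𝕜 Γ V 1 (h c) := fun c => rfl
  have hscont : Continuous s := by
    refine Continuous.subtype_mk ?_ _
    change Continuous fun c : cocycles ρ 2 =>
      (c : Cochain Γ V 2) + coboundary 𝕜 Γ V 1 (h c)
    exact continuous_subtype_val.add
      ((continuous_coboundary 1).comp (h.continuous.comp continuous_subtype_val))
  -- This is injectivity: any equivariant primitive of a cocycle of growth `N` automatically has
  -- growth `N + 1`.
  have hpolB : ∀ u : polCocycles ρ S N 2, (u : Cochain Γ V 2) ∈ coboundaries ρ 2 →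
      (u : Cochain Γ V 2) ∈ polCoboundaries ρ S (N + 1) N 2 := by
    rintro u ⟨b, hb, hbu⟩
    refine ⟨⟨b, ⟨hb, mem_polCochains_of_coboundary ρ hSf hS hN hb ?_⟩, hbu⟩, u.2.1⟩
    rw [hbu]
    exact u.2.1.2
  have hsB : (coboundaries ρ 2).submoduleOf (cocycles ρ 2)
      ≤ ((polCoboundaries ρ S (N + 1) N 2).submoduleOf (polCocycles ρ S N 2)).comap s := by
    intro c hc
    refine hpolB (s c) ?_
    rw [hs]
    exact Submodule.add_mem _ hc ⟨_, heq c c.2, rfl⟩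
  let inv : Cohomology ρ 2 →ₗ[𝕜] PolCohomology ρ S (N + 1) N 2 := Submodule.mapQ _ _ s hsB
  have hsub : ∀ c : cocycles ρ 2, ((Submodule.inclusion (polCocycles_le_cocycles ρ S N 2)) (s c)) - c
      ∈ (coboundaries ρ 2).submoduleOf (cocycles ρ 2) := by
    intro c
    refine ⟨h c, heq c c.2, ?_⟩
    change _ = ((s c : polCocycles ρ S N 2) : Cochain Γ V 2) - c
    rw [hs, add_sub_cancel_left]
  have hleft : ∀ x, inv (comparisonMap ρ S (N + 1) N 2 x) = x := by
    intro x
    obtain ⟨u, rfl⟩ := Submodule.Quotient.mk_surjective _ x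
    refine (Submodule.Quotient.eq _).2 ?_
    refine hpolB (s (Submodule.inclusion (polCocycles_le_cocycles ρ S N 2) u) - u) ?_
    exact hsub (Submodule.inclusion (polCocycles_le_cocycles ρ S N 2) u)
  have hright : ∀ x, comparisonMap ρ S (N + 1) N 2 (inv x) = x := by
    intro x
    obtain ⟨u, rfl⟩ := Submodule.Quotient.mk_surjective _ x
    exact (Submodule.Quotient.eq _).2 (hsub u)
  have hcont : Continuous (comparisonMap ρ S (N + 1) N 2) := by
    refine continuous_quot_lift _ ?_
    refine continuous_quot_mk.comp ?_
    exact Continuous.subtype_mk continuous_subtype_val _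
  have hinvcont : Continuous inv := by
    refine continuous_quot_lift _ ?_
    exact continuous_quot_mk.comp hscont
  exact ⟨⟨LinearEquiv.ofLinearMap (comparisonMap ρ S (N + 1) N 2) inv
    (LinearMap.ext hright) (LinearMap.ext hleft), hcont, hinvcont⟩, fun x => rfl⟩

end Cochains

/-! ### The case of a Dehn function of at least linear growth -/

section PathSumMore

variable {ι : Type*} {Γ : Type*} [Group Γ] {A : Type*} [AddCommGroup A]

/-- Additivity under concatenation determines a function of paths from its values on letters. The
identities for linear maps, exact terms and translations all follow from this. -/
theorem pathSum_unique (π : FreeGroup ι →* Γ) (α : Γ → Γ → A) (F : Γ → FreeGroup ι → A)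
    (hmul : ∀ g w w', F g (w * w') = F g w + F (g * π w) w')
    (hof : ∀ g i, F g (FreeGroup.of i) = α g (g * π (FreeGroup.of i))) (w : FreeGroup ι) :
    ∀ g, F g w = pathSum π α g w := by
  have h1 : ∀ g, F g 1 = 0 := fun g => by simpa using hmul g 1 1
  induction w using FreeGroup.induction_on with
  | C1 => intro g; rw [h1, pathSum_one]
  | of i => intro g; rw [hof, pathSum_of]
  | inv_of i ih =>
    intro g
    have h := hmul g (FreeGroup.of i)⁻¹ (FreeGroup.of i)
    rw [inv_mul_cancel, h1, map_inv, ih] at h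
    rw [pathSum_inv]
    exact eq_neg_of_add_eq_zero_left h.symm
  | mul x y hx hy => intro g; rw [hmul, hx, hy, pathSum_mul]

theorem map_pathSum {B : Type*} [AddCommGroup B] (π : FreeGroup ι →* Γ) (α : Γ → Γ → A)
    (φ : A →+ B) (g : Γ) (w : FreeGroup ι) :
    φ (pathSum π α g w) = pathSum π (fun u v => φ (α u v)) g w :=
  pathSum_unique π (fun u v => φ (α u v)) (fun g w => φ (pathSum π α g w))
    (fun g w w' => by rw [pathSum_mul, map_add]) (fun g i => by rw [pathSum_of]) w g

theorem pathSum_add_coboundary (π : FreeGroup ι →* Γ) (α : Γ → Γ → A) (k : Γ → A) (g : Γ)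
    (w : FreeGroup ι) :
    pathSum π (fun u v => α u v + (k v - k u)) g w
      = pathSum π α g w + (k (g * π w) - k g) :=
  (pathSum_unique π (fun u v => α u v + (k v - k u))
    (fun g w => pathSum π α g w + (k (g * π w) - k g))
    (fun g w w' => by rw [pathSum_mul, map_mul, mul_assoc]; abel)
    (fun g i => by rw [pathSum_of]) w g).symm

theorem pathSum_mul_left (π : FreeGroup ι →* Γ) (α : Γ → Γ → A) (h g : Γ) (w : FreeGroup ι) :
    pathSum π α (h * g) w = pathSum π (fun u v => α (h * u) (h * v)) g w :=
  pathSum_unique π (fun u v => α (h * u) (h * v)) (fun g w => pathSum π α (h * g) w)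
    (fun g w w' => by rw [pathSum_mul, mul_assoc]) (fun g i => by rw [pathSum_of, mul_assoc]) w g

end PathSumMore

/-- The linear terms of `GrowthLE` are absorbed in the power because 1 ≤ `N`. This is what separates
the two cases of the theorem. -/
theorem GrowthLE.exists_le_rpow {f : ℕ → ℝ} {N : ℝ} (hN : 1 ≤ N)
    (hf : GrowthLE f (fun t => t ^ N)) :
    ∃ K : ℝ, 0 ≤ K ∧ ∀ n : ℕ, 0 < n → f n ≤ K * (1 + n) ^ N := by
  obtain ⟨C, hC, h⟩ := hf
  refine ⟨C * C ^ N + C, by positivity, fun n hn => (h n hn).trans ?_⟩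
  have h1 : C * n + C = C * (1 + n) := by ring
  have h2 : (1 + n : ℝ) ≤ (1 + n) ^ N :=
    Real.self_le_rpow_of_one_le (by linarith [(Nat.cast_nonneg n : (0 : ℝ) ≤ n)]) hN
  have h3 := mul_le_mul_of_nonneg_left h2 hC.le
  simp only []
  rw [add_assoc, h1, Real.mul_rpow hC.le (by positivity), add_mul]
  linarith

/-! ### Coning cocycles along geodesic words -/

section PathCochain

variable {𝕜 : Type*} [RCLike 𝕜] {Γ : Type*} [Group Γ]
  {V : Type*} [NormedAddCommGroup V] [NormedSpace 𝕜 V]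

/-- The value of a cochain, as a continuous linear functional of the cochain. -/
def evalCochain (𝕜 : Type*) [RCLike 𝕜] {Γ : Type*}
    {V : Type*} [NormedAddCommGroup V] [NormedSpace 𝕜 V] {k : ℕ} (x : Fin (k + 1) → Γ) :
    Cochain Γ V k →L[𝕜] V :=
  ContinuousLinearMap.proj (R := 𝕜) (φ := fun _ : Fin (k + 1) → Γ => V) x

/-- Sums of a `2`-cochain over the triangles that cone off geodesic words. -/
noncomputable def FinitePresentation.coneCochain (𝕜 : Type*) [RCLike 𝕜] {Γ : Type*} [Group Γ]
    (V : Type*) [NormedAddCommGroup V] [NormedSpace 𝕜 V] (P : FinitePresentation Γ) :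
    Cochain Γ V 2 →L[𝕜] Cochain Γ V 1 :=
  ContinuousLinearMap.pi fun x =>
    pathSum P.proj (fun u v => evalCochain 𝕜 ![x 0, u, v]) (x 0) (P.word ((x 0)⁻¹ * x 1))

theorem FinitePresentation.coneCochain_apply (P : FinitePresentation Γ) (c : Cochain Γ V 2)
    (x y : Γ) : P.coneCochain 𝕜 V c ![x, y]
      = pathSum P.proj (fun u v => c ![x, u, v]) x (P.word (x⁻¹ * y)) :=
  map_pathSum P.proj (fun u v => evalCochain (V := V) 𝕜 ![x, u, v])
    (⟨⟨fun φ => φ c, rfl⟩, fun _ _ => rfl⟩ : (Cochain Γ V 2 →L[𝕜] V) →+ V) x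
    (P.word (x⁻¹ * y))

variable (ρ : Γ →* (V ≃ₗᵢ[𝕜] V)) {c : Cochain Γ V 2}

theorem pathSum_equivariant (hc : c ∈ cocycles ρ 2) {ι : Type*} (π : FreeGroup ι →* Γ)
    (h x g : Γ) (w : FreeGroup ι) :
    pathSum π (fun u v => c ![h * x, u, v]) (h * g) w
      = ρ h (pathSum π (fun u v => c ![x, u, v]) g w) := by
  rw [mem_cocycles_two_iff] at hc
  rw [pathSum_mul_left]
  simp only [hc.1]
  exact (map_pathSum π (fun u v => c ![x, u, v]) ((ρ h).toLinearEquiv.toLinearMap.toAddMonoidHom)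
    g w).symm

/-- By the cocycle identity, moving the cone vertex from x to y changes the edge function by the
difference of c(x, y, ·) at the ends of the edge, which telescopes. Sums over closed paths therefore
do not depend on the cone vertex. -/
theorem pathSum_change_base (hc : c ∈ cocycles ρ 2) {ι : Type*} (π : FreeGroup ι →* Γ)
    (x y g : Γ) (w : FreeGroup ι) :
    pathSum π (fun u v => c ![x, u, v]) g w
      = pathSum π (fun u v => c ![y, u, v]) g w + (c ![x, y, g * π w] - c ![x, y, g]) := by
  rw [mem_cocycles_two_iff] at hc
  rw [← pathSum_add_coboundary π _ (fun v => c ![x, y, v])]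
  congr 1
  funext u v
  have h := hc.2 x y u v
  have : c ![x, u, v] = c ![y, u, v] + (c ![x, y, v] - c ![x, y, u])
      - (c ![y, u, v] - c ![x, u, v] + c ![x, y, v] - c ![x, y, u]) := by abel
  rw [this, h, sub_zero]

theorem coneCochain_equivariant (P : FinitePresentation Γ) (hc : c ∈ cocycles ρ 2) :
    P.coneCochain 𝕜 V c ∈ equivariantCochains ρ 1 := by
  rw [mem_equivariantCochains_one_iff]
  intro g x y
  rw [P.coneCochain_apply, P.coneCochain_apply, pathSum_equivariant ρ hc,
    show (g * x)⁻¹ * (g * y) = x⁻¹ * y by group]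

/-- The three cones become one sum over a loop once the side from y to z is coned from x instead of
y; that change of vertex accounts for c(x, y, z) and leaves c(x, y, y). -/
theorem cone_add_coboundary (P : FinitePresentation Γ) (hc : c ∈ cocycles ρ 2) (x y z : Γ) :
    c ![x, y, z] + coboundary 𝕜 Γ V 1 (P.coneCochain 𝕜 V c) ![x, y, z]
      = pathSum P.proj (fun u v => c ![x, u, v]) x
          (P.word (x⁻¹ * y) * P.word (y⁻¹ * z) * (P.word (x⁻¹ * z))⁻¹) + c ![x, y, y] := by
  rw [coboundary_one_apply, P.coneCochain_apply, P.coneCochain_apply, P.coneCochain_apply,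
    pathSum_mul, pathSum_mul, pathSum_inv]
  simp only [map_mul, P.proj_word]
  simp only [mul_inv_cancel_left, mul_inv_rev, inv_inv]
  rw [pathSum_change_base ρ hc P.proj x y y, P.proj_word, mul_inv_cancel_left]
  rw [show x * (x⁻¹ * y * (y⁻¹ * z)) * (z⁻¹ * x) = x by group]
  abel

/-- Over a group whose Dehn function is bounded by `t ^ N` with `1 ≤ N`, coning off geodesic words
corrects every cocycle to one of growth at most `N`. -/
theorem cone_mem_polCochains (P : FinitePresentation Γ) {S : Set Γ} (hSf : S.Finite)
    (hS : Subgroup.closure S = ⊤) {N : ℝ} (hN : 1 ≤ N)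
    (hP : GrowthLE (fun n => (P.dehn n : ℝ)) (fun t => t ^ N)) (hc : c ∈ cocycles ρ 2) :
    c + coboundary 𝕜 Γ V 1 (P.coneCochain 𝕜 V c) ∈ polCochains 𝕜 V S N 2 := by
  obtain ⟨K, hK0, hK⟩ := hP.exists_le_rpow hN
  obtain ⟨D, hD⟩ := exists_len_le_wordLength hS hSf P
  obtain ⟨M, hM⟩ := (P.finite_rels.image fun r =>
    ‖pathSum P.proj (fun u v => c ![1, u, v]) 1 r‖).bddAbove
  -- A relator is a loop, so its cone vertex may be moved to its starting point and the whole
  -- picture translated to 1; only finitely many values remain.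
  have hM' : ∀ x g, ∀ r ∈ P.rels, ‖pathSum P.proj (fun u v => c ![x, u, v]) g r‖ ≤ |M| := by
    intro x g r hr
    rw [pathSum_change_base ρ hc P.proj x g, P.proj_eq_one_of_mem_rels hr, mul_one, sub_self,
      add_zero]
    have := pathSum_equivariant ρ hc P.proj g 1 1 r
    rw [mul_one] at this
    rw [this, LinearIsometryEquiv.norm_map]
    exact (hM ⟨r, hr, rfl⟩).trans (le_abs_self M)
  refine ⟨|M| * K * (2 * D + 2) ^ N + ‖c ![1, 1, 1]‖, fun x => ?_⟩
  rw [Fin.sum_univ_three]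
  set n : ℕ := wordLength S (x 0) + wordLength S (x 1) + wordLength S (x 2) with hn
  have hcast : (wordLength S (x 0) : ℝ) + wordLength S (x 1) + wordLength S (x 2) = n := by
    rw [hn]; push_cast; ring
  rw [hcast]
  have hlen : ∀ g h, P.len (g⁻¹ * h) ≤ D * wordLength S g + D * wordLength S h := fun g h => by
    have h1 := P.len_mul_le g⁻¹ h
    rw [P.len_inv] at h1
    exact h1.trans (Nat.add_le_add (hD g) (hD h))
  set w := P.word ((x 0)⁻¹ * x 1) * P.word ((x 1)⁻¹ * x 2) * (P.word ((x 0)⁻¹ * x 2))⁻¹ with hw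
  have hw1 : P.proj w = 1 := by
    simp only [hw, map_mul, map_inv, P.proj_word]; group
  -- Each vertex lies on two sides of the triangle. The extra 1 makes the argument of the Dehn
  -- function positive.
  have hw2 : w.norm ≤ 2 * D * n + 1 := by
    have h1 := FreeGroup.norm_mul_le (P.word ((x 0)⁻¹ * x 1) * P.word ((x 1)⁻¹ * x 2))
      (P.word ((x 0)⁻¹ * x 2))⁻¹
    have h2 := FreeGroup.norm_mul_le (P.word ((x 0)⁻¹ * x 1)) (P.word ((x 1)⁻¹ * x 2))
    rw [FreeGroup.norm_inv_eq, P.norm_word] at h1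
    rw [P.norm_word, P.norm_word] at h2
    have h3 := hlen (x 0) (x 1)
    have h4 := hlen (x 1) (x 2)
    have h5 := hlen (x 0) (x 2)
    rw [hn]
    nlinarith
  have h1 : (c + coboundary 𝕜 Γ V 1 (P.coneCochain 𝕜 V c)) x
      = pathSum P.proj (fun u v => c ![x 0, u, v]) (x 0) w + c ![x 0, x 1, x 1] := by
    rw [← cone_add_coboundary ρ P hc, vec_three_eta]; rfl
  -- The cocycle identity on (x 0, x 1, x 1, x 1) gives c(x 0, x 1, x 1) = c(x 1, x 1, x 1), which
  -- is a translate of c(1, 1, 1).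
  have h2 : ‖c ![x 0, x 1, x 1]‖ = ‖c ![1, 1, 1]‖ := by
    rw [mem_cocycles_two_iff] at hc
    have h := hc.2 (x 0) (x 1) (x 1) (x 1)
    have h' : c ![x 0, x 1, x 1] = c ![x 1, x 1, x 1] - (c ![x 1, x 1, x 1] - c ![x 0, x 1, x 1]
        + c ![x 0, x 1, x 1] - c ![x 0, x 1, x 1]) := by abel
    rw [h', h, sub_zero]
    have := hc.1 (x 1) 1 1 1
    rw [mul_one] at this
    rw [this, LinearIsometryEquiv.norm_map]
  have h3 := P.exists_norm_pathSum_le _ (abs_nonneg M) (hM' (x 0)) hw1 hw2 (x 0)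
  have h4 := hK (2 * D * n + 1) (by omega)
  have h5 : (1 + ((2 * D * n + 1 : ℕ) : ℝ)) ^ N ≤ (2 * D + 2) ^ N * (1 + n) ^ N := by
    rw [← Real.mul_rpow (by positivity) (by positivity)]
    refine Real.rpow_le_rpow (by positivity) ?_ (by linarith)
    push_cast
    nlinarith [(Nat.cast_nonneg n : (0 : ℝ) ≤ n), (Nat.cast_nonneg D : (0 : ℝ) ≤ D)]
  have h6 : 1 ≤ (1 + n : ℝ) ^ N :=
    Real.one_le_rpow (by linarith [(Nat.cast_nonneg n : (0 : ℝ) ≤ n)]) (by linarith)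
  rw [h1]
  calc _ ≤ |M| * P.dehn (2 * D * n + 1) + ‖c ![1, 1, 1]‖ :=
        (norm_add_le _ _).trans (add_le_add h3 h2.le)
    _ ≤ |M| * (K * ((2 * D + 2) ^ N * (1 + n) ^ N)) + ‖c ![1, 1, 1]‖ * (1 + n) ^ N :=
        add_le_add (mul_le_mul_of_nonneg_left
          (h4.trans (mul_le_mul_of_nonneg_left h5 hK0)) (abs_nonneg M))
          (le_mul_of_one_le_right (norm_nonneg _) h6)
    _ = _ := by ring

end PathCochain

/-! ### Hyperbolicity of groups with a linear Dehn function -/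

/-- The integral of `f dh` over an edge, up to a factor of two. -/
def edgeForm {X : Type*} (f h : X → ℤ) (u v : X) : ℤ := (f u + f v) * (h v - h u)

/-- `PathInt d α x y n s`: some edge path of length `n` from `x` to `y` has `α`-sum `s`. -/
inductive PathInt {X : Type*} (d : X → X → ℕ) (α : X → X → ℤ) : X → X → ℕ → ℤ → Prop
  | nil (x : X) : PathInt d α x x 0 0
  | cons {x y z : X} {n : ℕ} {s : ℤ} : d x y ≤ 1 → PathInt d α y z n s →
      PathInt d α x z (n + 1) (α x y + s)

/-- A homological form of a linear isoperimetric inequality: the integral of `f dh` over a closed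
path is at most linear in its length, for `1`-Lipschitz functions `f` and `h`. -/
def LinearFilling {X : Type*} (d : X → X → ℕ) (K : ℕ) : Prop :=
  ∀ f h : X → ℤ, (∀ u v, |f u - f v| ≤ d u v) → (∀ u v, |h u - h v| ≤ d u v) →
    ∀ x n s, PathInt d (edgeForm f h) x x n s → |s| ≤ K * n

section PathInt

variable {X : Type*} {d : X → X → ℕ} {α : X → X → ℤ}

theorem PathInt.append {x y z : X} {n m : ℕ} {s t : ℤ} (h : PathInt d α x y n s)
    (h' : PathInt d α y z m t) : PathInt d α x z (n + m) (s + t) := by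
  induction h with
  | nil => simpa using h'
  | cons hxy _ ih =>
    have := PathInt.cons hxy (ih h')
    convert this using 1
    · omega
    · ring

theorem PathInt.single {x y : X} (h : d x y ≤ 1) : PathInt d α x y 1 (α x y) := by
  simpa using PathInt.cons h (PathInt.nil y)

theorem PathInt.reverse (hs : ∀ x y, d x y = d y x) (hα : ∀ x y, α y x = - α x y) {x y : X}
    {n : ℕ} {s : ℤ} (h : PathInt d α x y n s) : PathInt d α y x n (-s) := by
  induction h with
  | nil => simpa using PathInt.nil _
  | @cons x y z n s hxy _ ih =>
    have := ih.append (PathInt.single (α := α) (x := y) (y := x) (by rwa [hs]))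
    rw [hα] at this
    convert this using 1
    ring

end PathInt

theorem edgeForm_symm {X : Type*} (f h : X → ℤ) (x y : X) :
    edgeForm f h y x = - edgeForm f h x y := by
  unfold edgeForm; ring

/-- For 0 < `N` ≤ 1 one has t ^ `N` ≤ 1 + t on t ≥ 0. -/
theorem GrowthLE.exists_le_linear {f : ℕ → ℝ} {N : ℝ} (hN0 : 0 < N) (hN : N ≤ 1)
    (hf : GrowthLE f (fun t => t ^ N)) : ∃ K : ℕ, ∀ n : ℕ, 0 < n → f n ≤ K * n := by
  obtain ⟨C, hC, h⟩ := hf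
  have hpow : ∀ t : ℝ, 0 ≤ t → t ^ N ≤ 1 + t := fun t ht => by
    rcases le_total t 1 with h1 | h1
    · linarith [Real.rpow_le_one ht h1 hN0.le]
    · have := Real.rpow_le_rpow_of_exponent_le h1 hN
      rw [Real.rpow_one] at this
      linarith
  refine ⟨⌈C * (1 + 2 * C) + 2 * C⌉₊, fun n hn => (h n hn).trans ?_⟩
  have hn1 : (1 : ℝ) ≤ n := by exact_mod_cast hn
  have h1 := mul_le_mul_of_nonneg_left (hpow (C * n + C) (by positivity)) hC.le
  have h2 := mul_le_mul_of_nonneg_right (Nat.le_ceil (C * (1 + 2 * C) + 2 * C))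
    (by linarith : (0 : ℝ) ≤ n)
  have h3 : C * (1 + (C * n + C)) + C * n + C ≤ (C * (1 + 2 * C) + 2 * C) * n := by
    have : 0 ≤ (C + C ^ 2 + C) * ((n : ℝ) - 1) := mul_nonneg (by positivity) (by linarith)
    nlinarith
  simp only [] at h1 ⊢
  linarith

/-! ### Integrals over loops under a linear Dehn function -/

section LinearDehn

variable {Γ : Type*} [Group Γ] (P : FinitePresentation Γ)

theorem FinitePresentation.pathSum_of_norm_le_one {α : Γ → Γ → ℤ} (h0 : ∀ x, α x x = 0)
    (hα : ∀ x y, α y x = - α x y) (x : Γ) {w : FreeGroup (Fin P.numGens)} (hw : w.norm ≤ 1) :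
    pathSum P.proj α x w = α x (x * P.proj w) := by
  have key : ∀ L : List (Fin P.numGens × Bool), L.length ≤ 1 →
      pathSum P.proj α x (FreeGroup.mk L) = α x (x * P.proj (FreeGroup.mk L)) := by
    intro L hL
    match L, hL with
    | [], _ =>
      change pathSum P.proj α x 1 = α x (x * P.proj 1)
      simp [h0]
    | [(i, true)], _ => exact pathSum_of P.proj α x i
    | [(i, false)], _ =>
      have : FreeGroup.mk [(i, false)] = (FreeGroup.of i)⁻¹ := by
        simp [FreeGroup.of, FreeGroup.inv_mk, FreeGroup.invRev]
      rw [this, pathSum_inv, pathSum_of, ← hα, map_inv]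
      simp
  have := key w.toWord hw
  rwa [FreeGroup.mk_toWord] at this

theorem FinitePresentation.exists_word_of_pathInt {α : Γ → Γ → ℤ} (h0 : ∀ x, α x x = 0)
    (hα : ∀ x y, α y x = - α x y) {x y : Γ} {n : ℕ} {s : ℤ} (h : PathInt P.dist α x y n s) :
    ∃ w, P.proj w = x⁻¹ * y ∧ w.norm ≤ n ∧ pathSum P.proj α x w = s := by
  induction h with
  | nil x => exact ⟨1, by simp, by simp, by simp⟩
  | @cons x y z n s hxy _ ih =>
    obtain ⟨w, h1, h2, h3⟩ := ih
    refine ⟨P.word (x⁻¹ * y) * w, by simp [h1, mul_assoc], ?_, ?_⟩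
    · have := FreeGroup.norm_mul_le (P.word (x⁻¹ * y)) w
      rw [P.norm_word] at this
      unfold dist at hxy
      omega
    · rw [pathSum_mul, P.pathSum_of_norm_le_one h0 hα x (by rw [P.norm_word]; exact hxy)]
      simp [h3]

/-- The subtracted term is twice the integral of the constant f(g). Along a path of length n from g,
f differs from f(g) by at most n and h changes by at most 1 per edge, whence the order n². On a
closed path the subtracted term vanishes. -/
theorem FinitePresentation.abs_pathSum_edgeForm_le {f h : Γ → ℤ}
    (hf : ∀ u v, |f u - f v| ≤ P.dist u v) (hh : ∀ u v, |h u - h v| ≤ P.dist u v)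
    (w : FreeGroup (Fin P.numGens)) :
    ∀ g, |pathSum P.proj (edgeForm f h) g w - 2 * f g * (h (g * P.proj w) - h g)|
      ≤ 2 * (w.norm : ℤ) ^ 2 := by
  have hlen : ∀ (g : Γ) (w : FreeGroup (Fin P.numGens)) (n : ℕ), w.norm ≤ n →
      P.dist g (g * P.proj w) ≤ n := fun g w n hn => by
    have := P.len_proj_le w
    simp only [dist, inv_mul_cancel_left]
    omega
  have hstep : ∀ (a w : FreeGroup (Fin P.numGens)) (n : ℕ), a.norm ≤ 1 → w.norm ≤ n →
      (∀ g, |pathSum P.proj (edgeForm f h) g w - 2 * f g * (h (g * P.proj w) - h g)|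
        ≤ 2 * (n : ℤ) ^ 2) →
      ∀ g, |pathSum P.proj (edgeForm f h) g (a * w) - 2 * f g * (h (g * P.proj (a * w)) - h g)|
        ≤ 2 * ((n + 1 : ℕ) : ℤ) ^ 2 := by
    intro a w n ha hw ih g
    rw [pathSum_mul, P.pathSum_of_norm_le_one (fun x => by simp [edgeForm])
      (edgeForm_symm f h) g ha, map_mul, ← mul_assoc]
    have h1 := ih (g * P.proj a)
    set g' := g * P.proj a
    set e := g' * P.proj w
    have hd1 : P.dist g g' ≤ 1 := hlen g a 1 ha
    have hd2 : P.dist g' e ≤ n := hlen g' w n hw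
    have hf1 : |f g - f g'| ≤ 1 := (hf g g').trans (by exact_mod_cast hd1)
    have hh1 : |h g - h g'| ≤ 1 := (hh g g').trans (by exact_mod_cast hd1)
    have hh2 : |h g' - h e| ≤ n := (hh g' e).trans (by exact_mod_cast hd2)
    -- Replacing the reference value f(g') by f(g) adds errors of at most 1 and 2n, and 2n² + 2n + 1
    -- ≤ 2(n + 1)².
    have e1 : edgeForm f h g g' + pathSum P.proj (edgeForm f h) g' w - 2 * f g * (h e - h g)
        = (pathSum P.proj (edgeForm f h) g' w - 2 * f g' * (h e - h g'))
          + (f g - f g') * (h g - h g') + 2 * ((f g - f g') * (h g' - h e)) := by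
      unfold edgeForm; ring
    have h2 : |(f g - f g') * (h g - h g')| ≤ 1 := by
      rw [abs_mul]; exact mul_le_one₀ hf1 (abs_nonneg _) hh1
    have h3 : |(f g - f g') * (h g' - h e)| ≤ n := by
      rw [abs_mul]
      calc _ ≤ 1 * (n : ℤ) := mul_le_mul hf1 hh2 (abs_nonneg _) (by norm_num)
        _ = n := one_mul _
    rw [e1]
    rw [abs_le] at h1 h2 h3 ⊢
    push_cast
    constructor <;> nlinarith [h1.1, h1.2, h2.1, h2.2, h3.1, h3.2]
  refine (FreeGroup_induction_word (C := fun w n => w.norm ≤ n ∧ ∀ g,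
    |pathSum P.proj (edgeForm f h) g w - 2 * f g * (h (g * P.proj w) - h g)| ≤ 2 * (n : ℤ) ^ 2)
    ⟨by simp, fun g => by simp⟩ (fun i w n hn => ⟨⟨?_, ?_⟩, ?_, ?_⟩) w).2
  · have := FreeGroup.norm_mul_le (FreeGroup.of i) w
    rw [FreeGroup.norm_of] at this
    omega
  · exact hstep _ w n (FreeGroup.norm_of i).le hn.1 hn.2
  · have := FreeGroup.norm_mul_le (FreeGroup.of i)⁻¹ w
    rw [FreeGroup.norm_inv_eq, FreeGroup.norm_of] at this
    omega
  · exact hstep _ w n (by rw [FreeGroup.norm_inv_eq, FreeGroup.norm_of]) hn.1 hn.2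

/-- A discrete Stokes theorem: a relator of length at most `R` contributes at most 2`R`² to the
integral, uniformly in its position and in the Lipschitz functions, and a loop of length n is a
product of at most `C` n conjugates of relators. -/
theorem FinitePresentation.exists_linearFilling {C : ℕ}
    (hC : ∀ n : ℕ, 0 < n → P.dehn n ≤ C * n) : ∃ K, LinearFilling P.dist K := by
  obtain ⟨R, hR⟩ := (P.finite_rels.image FreeGroup.norm).bddAbove
  refine ⟨2 * R ^ 2 * C, fun f h hf hh x n s hs => ?_⟩
  obtain ⟨w, hw1, hw2, rfl⟩ := P.exists_word_of_pathInt (fun x => by simp [edgeForm])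
    (edgeForm_symm f h) hs
  rw [inv_mul_cancel] at hw1
  rcases Nat.eq_zero_or_pos n with rfl | hn
  · have : w = 1 := FreeGroup.norm_eq_zero.1 (Nat.le_zero.1 hw2)
    simp [this]
  have hM : ∀ g, ∀ r ∈ P.rels, ‖pathSum P.proj (edgeForm f h) g r‖ ≤ 2 * (R : ℝ) ^ 2 := by
    intro g r hr
    have h1 := P.abs_pathSum_edgeForm_le hf hh r g
    rw [P.proj_eq_one_of_mem_rels hr, mul_one, sub_self, mul_zero, sub_zero] at h1
    have h2 : r.norm ≤ R := hR ⟨r, hr, rfl⟩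
    rw [Int.norm_eq_abs]
    have h3 : |pathSum P.proj (edgeForm f h) g r| ≤ 2 * (R : ℤ) ^ 2 := by
      refine h1.trans ?_
      have : (r.norm : ℤ) ≤ R := by exact_mod_cast h2
      gcongr
    exact_mod_cast h3
  have h1 := P.exists_norm_pathSum_le _ (by positivity) hM hw1 hw2 x
  rw [Int.norm_eq_abs] at h1
  have h2 : (P.dehn n : ℝ) ≤ C * n := by exact_mod_cast hC n hn
  have h3 : ((|pathSum P.proj (edgeForm f h) x w| : ℤ) : ℝ) ≤ 2 * (R : ℝ) ^ 2 * (C * n) := by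
    rw [Int.cast_abs]
    exact h1.trans (mul_le_mul_of_nonneg_left h2 (by positivity))
  have h4 : |pathSum P.proj (edgeForm f h) x w| ≤ 2 * (R : ℤ) ^ 2 * (C * n) := by
    exact_mod_cast h3
  refine h4.trans (le_of_eq ?_)
  push_cast
  ring

end LinearDehn

/-- The four-point condition of Gromov. -/
def FourPoint {X : Type*} (d : X → X → ℕ) (δ : ℕ) : Prop :=
  ∀ a b c e, d a b + d c e ≤ max (d a c + d b e) (d a e + d b c) + δ

/-- A discrete geodesic of length `n`. -/
def IsGeod {X : Type*} (d : X → X → ℕ) (γ : ℕ → X) (n : ℕ) : Prop :=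
  ∀ i j, i ≤ j → j ≤ n → d (γ i) (γ j) + i = j

/-! ### Stability of geodesics, slim triangles and the four-point condition -/

namespace IsGraphMetric

variable {X : Type*} {d : X → X → ℕ} (hd : IsGraphMetric d)
include hd

theorem exists_isGeod (x y : X) :
    ∃ γ : ℕ → X, γ 0 = x ∧ γ (d x y) = y ∧ IsGeod d γ (d x y) := by
  have key : ∀ n y, d x y = n → ∃ γ : ℕ → X, γ 0 = x ∧ γ n = y ∧ IsGeod d γ n := by
    intro n
    induction n with
    | zero =>
      intro y h
      refine ⟨fun _ => x, rfl, hd.eq_of _ _ h, fun i j hij hj => ?_⟩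
      simp only [hd.self]
      omega
    | succ n ih =>
      intro y h
      obtain ⟨u, hu, huy⟩ := hd.between x y n (by omega)
      obtain ⟨γ, h0, h1, hγ⟩ := ih u hu
      refine ⟨fun i => if i ≤ n then γ i else y, by simp [h0], by simp, fun i j hij hj => ?_⟩
      by_cases hjn : j ≤ n
      · have hi : i ≤ n := hij.trans hjn
        simp only [hi, hjn, if_true]
        exact hγ i j hij hjn
      · by_cases hi : i ≤ n
        · simp only [hi, hjn, if_true, if_false]
          have e1 := hγ i n hi le_rfl
          have e2 := hγ 0 i (by omega) hi
          rw [h0] at e2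
          rw [h1] at e1
          have e3 := hd.tri (γ i) u y
          have e4 := hd.tri x (γ i) y
          omega
        · simp only [hi, hjn, if_false, hd.self]
          omega
  exact key _ y rfl

theorem pathInt_isGeod {f h : X → ℤ} {γ : ℕ → X} {n : ℕ} (hγ : IsGeod d γ n)
    (hf : ∀ k, k ≤ n → f (γ k) = 0) {i j : ℕ} (hi : i ≤ n) (hj : j ≤ n) :
    PathInt d (edgeForm f h) (γ i) (γ j) (d (γ i) (γ j)) 0 := by
  have key : ∀ m i, i + m ≤ n → PathInt d (edgeForm f h) (γ i) (γ (i + m)) m 0 := by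
    intro m
    induction m with
    | zero => intro i _; exact PathInt.nil _
    | succ m ih =>
      intro i hi
      have h1 := ih (i + 1) (by omega)
      have h2 : d (γ i) (γ (i + 1)) ≤ 1 := by
        have := hγ i (i + 1) (by omega) (by omega); omega
      have h3 := PathInt.cons (α := edgeForm f h) h2 h1
      have e : edgeForm f h (γ i) (γ (i + 1)) = 0 := by
        simp [edgeForm, hf i (by omega), hf (i + 1) (by omega)]
      rw [e, add_zero, show i + 1 + m = i + (m + 1) by omega] at h3
      exact h3
  rcases le_total i j with hij | hij
  · have h1 := hγ i j hij hj
    have h2 := key (j - i) i (by omega)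
    rw [show i + (j - i) = j by omega] at h2
    rwa [show d (γ i) (γ j) = j - i by omega]
  · have h1 := hγ j i hij hi
    have h2 := (key (i - j) j (by omega)).reverse hd.symm (edgeForm_symm f h)
    rw [show j + (i - j) = i by omega, neg_zero] at h2
    rw [hd.symm]
    rwa [show d (γ j) (γ i) = i - j by omega]

/-- The integral of `f dh` along a geodesic ending in `m`, where `f` is the distance to the
complement of a ball about `m` and `h` grows at unit speed `ε` along the geodesic. -/
theorem pathInt_to_center (m : X) (ρ : ℕ) (h : X → ℤ) (ε : ℤ) (Q : X → Prop)
    (hQ : ∀ u v, Q u → d u v + d v m = d u m → Q v)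
    (hh : ∀ u, Q u → h u = h m - ε * d u m) :
    ∀ t u, Q u → d u m = t →
      PathInt d (edgeForm (fun w => max ((ρ : ℤ) - d w m) 0) h) u m t
        (ε * ((ρ : ℤ) ^ 2 - (max ((ρ : ℤ) - t) 0) ^ 2)) := by
  intro t
  induction t with
  | zero =>
    intro u _ hu
    rw [hd.eq_of _ _ hu]
    have := PathInt.nil (d := d) (α := edgeForm (fun w => max ((ρ : ℤ) - d w m) 0) h) m
    simpa using this
  | succ t ih =>
    intro u hQu hu
    obtain ⟨v, hv, hvm⟩ := hd.between u m 1 (by omega)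
    have hQv := hQ u v hQu hvm
    have hvt : d v m = t := by omega
    have h1 := PathInt.cons (α := edgeForm (fun w => max ((ρ : ℤ) - d w m) 0) h) hv.le
      (ih v hQv hvt)
    convert h1 using 1
    simp only [edgeForm, hh u hQu, hh v hQv, hu, hvt]
    push_cast
    rcases le_total ((ρ : ℤ)) t with h2 | h2
    · rw [max_eq_right (by omega), max_eq_right (by omega)]; ring
    · rcases eq_or_lt_of_le h2 with h3 | h3
      · rw [max_eq_right (by omega), max_eq_right (by omega)]; ring
      · rw [max_eq_left (by omega), max_eq_left (by omega)]; ring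

/-- A point on a geodesic can be moved away from `m` along the geodesic and from there be joined to
a set `S` without entering the ball of radius `ρ` about `m`. -/
theorem exists_exit (m e : X) (ρ : ℕ) (h : X → ℤ) (S : X → Prop) (hSe : S e)
    (hρ : ∀ p, S p → ρ ≤ d m p)
    (hnear : ∀ u, d e u + d u m = d e m → ∃ p, S p ∧ d u p ≤ ρ) :
    ∃ u p n, d e u + d u m = d e m ∧ ρ ≤ d u m ∧ d u m ≤ 2 * ρ ∧ S p ∧ n ≤ ρ ∧ d u p ≤ ρ ∧
      PathInt d (edgeForm (fun w => max ((ρ : ℤ) - d w m) 0) h) u p n 0 := by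
  -- If e is far, the exit point is chosen at distance 2ρ from m: a geodesic of length at most ρ
  -- from there stays outside the open ball of radius ρ, where the bump function vanishes. Otherwise
  -- e itself is close enough and already in `S`.
  rcases le_total (2 * ρ) (d e m) with h1 | h1
  · obtain ⟨u, hu, hu'⟩ := hd.between m e (2 * ρ) (by rwa [hd.symm])
    have e1 := hd.symm m u
    have e2 := hd.symm e u
    have e3 := hd.symm e m
    obtain ⟨p, hp, hup⟩ := hnear u (by omega)
    obtain ⟨γ, h0, h2, hγ⟩ := hd.exists_isGeod u p
    refine ⟨u, p, d u p, by omega, by omega, by omega, hp, hup, hup, ?_⟩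
    have := hd.pathInt_isGeod (f := fun w => max ((ρ : ℤ) - d w m) 0) (h := h) hγ
      (fun k hk => ?_) (Nat.zero_le _) le_rfl
    · rwa [h0, h2] at this
    · have e4 := hγ 0 k (Nat.zero_le _) hk
      rw [h0] at e4
      have e5 := hd.tri u (γ k) m
      exact max_eq_right (by omega)
  · have h2 := hρ e hSe
    rw [hd.symm] at h2
    exact ⟨e, e, 0, by simp [hd.self], h2, h1, hSe, Nat.zero_le _, by simp [hd.self],
      PathInt.nil _⟩

/-- Under a linear filling inequality, a point of a geodesic at maximal distance `ρ` from a set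
whose points are joined inside the set by paths of linearly bounded length is near that set. -/
theorem le_of_linearFilling {K : ℕ} (hK : LinearFilling d K) (A B : ℕ) (S : X → Prop) {x y m : X}
    (hm : d x m + d m y = d x y) (hSx : S x) (hSy : S y) {ρ : ℕ} (hmS : ∀ p, S p → ρ ≤ d m p)
    (hnear : ∀ u, d x u + d u y = d x y → ∃ p, S p ∧ d u p ≤ ρ)
    (hconn : ∀ f h : X → ℤ, (∀ p, S p → f p = 0) → ∀ p p', S p → S p' →
      ∃ k, k ≤ (A + 1) * d p p' + B ∧ PathInt d (edgeForm f h) p' p k 0) :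
    ρ ≤ K * (12 + 6 * A + B) := by
  set f : X → ℤ := fun w => max ((ρ : ℤ) - d w m) 0 with hf
  set h : X → ℤ := fun w => (d x w : ℤ) with hh
  have hf0 : ∀ p, S p → f p = 0 := fun p hp => by
    have := hmS p hp
    rw [hd.symm] at this
    exact max_eq_right (by omega)
  have hflip : ∀ u v, |f u - f v| ≤ d u v := fun u v => by
    have h1 := hd.tri u v m
    have h2 := hd.tri v u m
    have h3 := hd.symm u v
    simp only [hf]
    rw [abs_le]
    omega
  have hhlip : ∀ u v, |h u - h v| ≤ d u v := fun u v => by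
    have h1 := hd.tri x u v
    have h2 := hd.tri x v u
    have h3 := hd.symm u v
    simp only [hh]
    rw [abs_le]
    omega
  obtain ⟨u, p, n1, hu1, hu2, hu3, hp, hn1, hup, hpath1⟩ :=
    hd.exists_exit m x ρ h S hSx hmS (fun u hu => hnear u (by
      have h1 := hd.tri u m y
      have h2 := hd.tri x u y
      omega))
  obtain ⟨v, p', n2, hv1, hv2, hv3, hp', hn2, hvp, hpath2⟩ :=
    hd.exists_exit m y ρ h S hSy hmS (fun u hu => hnear u (by
      have h1 := hd.tri x m u
      have h2 := hd.tri x u y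
      have h3 := hd.symm u y
      have h4 := hd.symm u m
      have h5 := hd.symm m y
      omega))
  have hmid1 := hd.pathInt_to_center m ρ h 1 (fun u => d x u + d u m = d x m)
    (fun u v hu huv => by
      have h1 := hd.tri x u v
      have h2 := hd.tri x v m
      omega) (fun u hu => by simp only [hh]; omega) (d u m) u hu1 rfl
  have hmid2 := hd.pathInt_to_center m ρ h (-1) (fun v => d x m + d m v = d x v)
    (fun u v hu huv => by
      have h1 := hd.tri x v u
      have h2 := hd.tri x m v
      have h3 := hd.symm u v
      have h4 := hd.symm u m
      have h5 := hd.symm v m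
      omega) (fun u hu => by
      have h4 := hd.symm u m
      simp only [hh]; omega) (d v m) v (by
      have h1 := hd.tri x v y
      have h2 := hd.tri x m v
      have h3 := hd.symm v y
      have h4 := hd.symm v m
      have h5 := hd.symm m y
      omega) rfl
  -- Both exit points are at distance at least ρ from m, so each half of the geodesic contributes
  -- the full ρ².
  rw [max_eq_right (by omega)] at hmid1 hmid2
  have hfs := edgeForm_symm f h
  obtain ⟨k, hk, hpath3⟩ := hconn f h hf0 p p' hp hp'
  -- The loop runs u, m, v along the geodesic, then to p' in `S`, through `S` to p, and back to u.
  -- Only the part through m has nonzero integral, namely 2ρ².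
  have hloop := (((hmid1.append (hmid2.reverse hd.symm hfs)).append hpath2).append hpath3).append
    (hpath1.reverse hd.symm hfs)
  have hfill := hK f h hflip hhlip _ _ _ hloop
  -- The path p, u, m, v, p' has pieces of lengths at most ρ, 2ρ, 2ρ, ρ.
  have hpp : d p p' ≤ 6 * ρ := by
    have h1 := hd.tri p u p'
    have h2 := hd.tri u m p'
    have h3 := hd.tri m v p'
    have h4 := hd.symm p u
    have h5 := hd.symm m v
    omega
  have hAp : A * d p p' ≤ A * (6 * ρ) := Nat.mul_le_mul_left A hpp
  have hlen : d u m + d v m + n2 + k + n1 ≤ 12 * ρ + A * (6 * ρ) + B := by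
    rw [add_mul, one_mul] at hk
    omega
  have h1 : 2 * ρ ^ 2 ≤ K * (12 * ρ + A * (6 * ρ) + B) := by
    have h2 := (le_abs_self _).trans hfill
    have h3 : (K : ℤ) * ((d u m + d v m + n2 + k + n1 : ℕ) : ℤ)
        ≤ K * ((12 * ρ + A * (6 * ρ) + B : ℕ) : ℤ) := by
      have : ((d u m + d v m + n2 + k + n1 : ℕ) : ℤ) ≤ ((12 * ρ + A * (6 * ρ) + B : ℕ) : ℤ) := by
        exact_mod_cast hlen
      gcongr
    have h4 := h2.trans h3
    have : (2 * ρ ^ 2 : ℤ) ≤ K * ((12 * ρ + A * (6 * ρ) + B : ℕ) : ℤ) := by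
      refine le_trans (le_of_eq ?_) h4
      ring
    exact_mod_cast this
  by_contra hcon
  push Not at hcon
  have hρ1 : 1 ≤ ρ := by omega
  have h2 : 12 * ρ + A * (6 * ρ) + B ≤ (12 + 6 * A + B) * ρ := by
    have : B ≤ B * ρ := Nat.le_mul_of_pos_right B hρ1
    calc _ ≤ 12 * ρ + A * (6 * ρ) + B * ρ := by omega
      _ = _ := by ring
  have h3 : K * (12 * ρ + A * (6 * ρ) + B) ≤ K * (12 + 6 * A + B) * ρ :=
    (Nat.mul_le_mul_left K h2).trans_eq (by ring)
  have h4 : K * (12 + 6 * A + B) * ρ ≤ ρ * ρ := Nat.mul_le_mul_right ρ hcon.le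
  have h5 : 0 < ρ * ρ := Nat.mul_pos hρ1 hρ1
  have h6 : 2 * ρ ^ 2 = ρ * ρ + ρ * ρ := by ring
  omega

/-- Stability of geodesics: under a linear filling inequality, a geodesic stays near a
quasi-geodesic made of two geodesics. -/
theorem exists_near_of_linearFilling {K : ℕ} (hK : LinearFilling d K) (A B : ℕ) :
    ∃ r : ℕ, ∀ (x y q : X) (γ γ' : ℕ → X), γ 0 = x → γ (d x q) = q → IsGeod d γ (d x q) →
      γ' 0 = q → γ' (d q y) = y → IsGeod d γ' (d q y) →
      (∀ i j, i ≤ d x q → j ≤ d q y →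
        d (γ i) q + d q (γ' j) ≤ A * d (γ i) (γ' j) + B) →
      ∀ m, d x m + d m y = d x y →
        (∃ i, i ≤ d x q ∧ d m (γ i) ≤ r) ∨ (∃ j, j ≤ d q y ∧ d m (γ' j) ≤ r) := by
  refine ⟨K * (12 + 6 * A + B), fun x y q γ γ' hx hq hγ hq' hy hγ' hqg => ?_⟩
  set r := K * (12 + 6 * A + B)
  set S : X → Prop := fun p => (∃ i, i ≤ d x q ∧ γ i = p) ∨ (∃ j, j ≤ d q y ∧ γ' j = p)
  have hSx : S x := Or.inl ⟨0, Nat.zero_le _, hx⟩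
  have hSy : S y := Or.inr ⟨_, le_rfl, hy⟩
  suffices H : ∀ m, d x m + d m y = d x y → ∃ p, S p ∧ d m p ≤ r by
    intro m hm
    obtain ⟨p, ⟨i, hi, rfl⟩ | ⟨j, hj, rfl⟩, hp⟩ := H m hm
    · exact Or.inl ⟨i, hi, hp⟩
    · exact Or.inr ⟨j, hj, hp⟩
  classical
  -- The greatest ρ satisfying `Φ` is the largest distance from a point of a geodesic to `S`; its
  -- maximality makes every other such point ρ-close to `S`.
  set Φ : ℕ → Prop := fun ρ => ∃ m, d x m + d m y = d x y ∧ ∀ p, S p → ρ ≤ d m p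
  have hΦ0 : Φ 0 := ⟨x, by simp [hd.self], fun p _ => Nat.zero_le _⟩
  have hΦb : ∀ ρ, Φ ρ → ρ ≤ d x y := by
    rintro ρ ⟨m, hm, hρ⟩
    have := hρ x hSx
    rw [hd.symm] at this
    omega
  set ρ := Nat.findGreatest Φ (d x y) with hρdef
  have hΦρ : Φ ρ := Nat.findGreatest_spec (Nat.zero_le _) hΦ0
  have hnear : ∀ m, d x m + d m y = d x y → ∃ p, S p ∧ d m p ≤ ρ := by
    intro m hm
    by_contra hcon
    push Not at hcon
    have h1 : Φ (ρ + 1) := ⟨m, hm, fun p hp => hcon p hp⟩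
    have := Nat.le_findGreatest (hΦb _ h1) h1
    omega
  suffices hρr : ρ ≤ r by
    intro m hm
    obtain ⟨p, hp, hp'⟩ := hnear m hm
    exact ⟨p, hp, hp'.trans hρr⟩
  obtain ⟨m, hm, hmS⟩ := hΦρ
  refine hd.le_of_linearFilling hK A B S hm hSx hSy hmS hnear ?_
  intro f h hf0 p p' hp hp'
  have hfs := edgeForm_symm f h
  have hsym := hd.symm p' p
  have hAd : d p p' ≤ (A + 1) * d p p' + B := by
    rw [add_mul, one_mul]
    omega
  have hS1 : ∀ k, k ≤ d x q → f (γ k) = 0 := fun k hk => hf0 _ (Or.inl ⟨k, hk, rfl⟩)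
  have hS2 : ∀ k, k ≤ d q y → f (γ' k) = 0 := fun k hk => hf0 _ (Or.inr ⟨k, hk, rfl⟩)
  have hcross : ∀ i j, i ≤ d x q → j ≤ d q y →
      PathInt d (edgeForm f h) (γ i) (γ' j) (d (γ i) q + d q (γ' j)) 0 := by
    intro i j hi hj
    have h1 := hd.pathInt_isGeod (h := h) hγ hS1 hi le_rfl
    have h2 := hd.pathInt_isGeod (h := h) hγ' hS2 (Nat.zero_le _) hj
    rw [hq] at h1
    rw [hq'] at h2
    simpa using h1.append h2
  rcases hp with ⟨i, hi, rfl⟩ | ⟨i, hi, rfl⟩ <;> rcases hp' with ⟨j, hj, rfl⟩ | ⟨j, hj, rfl⟩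
  · exact ⟨_, hsym.trans_le hAd, hd.pathInt_isGeod hγ hS1 hj hi⟩
  · refine ⟨_, ?_, by simpa using (hcross i j hi hj).reverse hd.symm hfs⟩
    have := hqg i j hi hj
    rw [add_mul, one_mul]
    omega
  · refine ⟨_, ?_, hcross j i hj hi⟩
    have := hqg j i hj hi
    rw [hd.symm (γ' i), add_mul, one_mul]
    omega
  · exact ⟨_, hsym.trans_le hAd, hd.pathInt_isGeod hγ' hS2 hj hi⟩

/-- The nearest point of `[x, p]` to `z`, if it is `p`, is near any geodesic from `x` to `z`. -/
theorem exists_near_projection {K : ℕ} (hK : LinearFilling d K) :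
    ∃ r : ℕ, ∀ x p z, (∀ a, d x a + d a p = d x p → d z p ≤ d z a) →
      ∃ m, d x m + d m z = d x z ∧ d p m ≤ r := by
  obtain ⟨r, hr⟩ := hd.exists_near_of_linearFilling hK 3 0
  refine ⟨7 * r + 3, fun x p z hmin => ?_⟩
  obtain ⟨γ, hx, hp, hγ⟩ := hd.exists_isGeod x p
  obtain ⟨γ', hp', hz, hγ'⟩ := hd.exists_isGeod p z
  obtain ⟨σ, hσx, hσz, hσ⟩ := hd.exists_isGeod x z
  -- Since p is the nearest point to z, it is also nearest to each point of [p, z]. Thus d(p, γ' j)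
  -- ≤ d(γ i, γ' j), then d(γ i, p) ≤ 2 d(γ i, γ' j), and the constant is 3.
  have hqg : ∀ i j, i ≤ d x p → j ≤ d p z →
      d (γ i) p + d p (γ' j) ≤ 3 * d (γ i) (γ' j) + 0 := by
    intro i j hi hj
    have h1 := hγ 0 i (Nat.zero_le _) hi
    have h2 := hγ i _ hi le_rfl
    have h3 := hγ' 0 j (Nat.zero_le _) hj
    have h4 := hγ' j _ hj le_rfl
    rw [hx] at h1
    rw [hp] at h2
    rw [hp'] at h3
    rw [hz] at h4
    have h5 := hmin (γ i) (by omega)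
    have h6 := hd.tri z (γ' j) (γ i)
    have h7 := hd.tri (γ i) (γ' j) p
    have h8 := hd.symm z (γ' j)
    have h9 := hd.symm (γ i) (γ' j)
    have h10 := hd.symm p (γ' j)
    have h11 := hd.symm p z
    omega
  have hn := hr x z p γ γ' hx hp hγ hp' hz hγ' hqg
  have hσI : ∀ k, k ≤ d x z → d x (σ k) + d (σ k) z = d x z := by
    intro k hk
    have h1 := hσ 0 k (Nat.zero_le _) hk
    have h2 := hσ k _ hk le_rfl
    rw [hσx] at h1
    rw [hσz] at h2
    omega
  by_cases hend : ∃ i, i ≤ d x p ∧ d z (γ i) ≤ r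
  · obtain ⟨i, hi, hzi⟩ := hend
    have h1 := hqg i _ hi le_rfl
    rw [hz] at h1
    refine ⟨z, by simp [hd.self], ?_⟩
    have := hd.symm z (γ i)
    omega
  -- The geodesic σ starts near [x, p] and ends away from it. Where it leaves, points of the two
  -- sides are within 2r + 1, hence within 6r + 3 of p in total by `hqg`, and p is within 7r + 3 of
  -- σ.
  · have hswitch : ∃ k, k < d x z ∧ (∃ i, i ≤ d x p ∧ d (σ k) (γ i) ≤ r) ∧
        ¬ ∃ i, i ≤ d x p ∧ d (σ (k + 1)) (γ i) ≤ r := by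
      by_contra hcon
      push Not at hcon
      have : ∀ k, k ≤ d x z → ∃ i, i ≤ d x p ∧ d (σ k) (γ i) ≤ r := by
        intro k
        induction k with
        | zero => intro _; exact ⟨0, Nat.zero_le _, by simp [hσx, hx, hd.self]⟩
        | succ k ih => intro hk; exact hcon k (by omega) (ih (by omega))
      exact hend (by simpa [hσz] using this _ le_rfl)
    obtain ⟨k, hk, ⟨i, hi, hki⟩, hk2⟩ := hswitch
    obtain ⟨j, hj, hkj⟩ := (hn (σ (k + 1)) (hσI _ hk)).resolve_left hk2
    refine ⟨σ k, hσI k hk.le, ?_⟩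
    have h1 := hqg i j hi hj
    have h2 := hσ k (k + 1) (by omega) hk
    have h3 := hd.tri (γ i) (σ k) (γ' j)
    have h4 := hd.tri (σ k) (σ (k + 1)) (γ' j)
    have h5 := hd.tri p (γ i) (σ k)
    have h6 := hd.symm (γ i) (σ k)
    have h7 := hd.symm (γ i) p
    omega

theorem exists_nearest (x y z : X) : ∃ p, d x p + d p y = d x y ∧
    ∀ a, d x a + d a y = d x y → d z p ≤ d z a := by
  classical
  have h : ∃ n, ∃ p, d x p + d p y = d x y ∧ d z p = n := ⟨_, x, by simp [hd.self], rfl⟩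
  obtain ⟨p, hp, hpn⟩ := Nat.find_spec h
  refine ⟨p, hp, fun a ha => ?_⟩
  rw [hpn]
  exact Nat.find_min' h ⟨a, ha, rfl⟩

/-- Geodesics from `x` to a nearest point are near geodesics from `x`. -/
theorem exists_near_of_projection {K : ℕ} (hK : LinearFilling d K) :
    ∃ r : ℕ, ∀ x p z, (∀ a, d x a + d a p = d x p → d z p ≤ d z a) →
      ∀ u, d x u + d u p = d x p → ∃ v, d x v + d v z = d x z ∧ d u v ≤ r := by
  obtain ⟨r1, hr1⟩ := hd.exists_near_projection hK
  obtain ⟨r2, hr2⟩ := hd.exists_near_of_linearFilling hK 1 (2 * r1)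
  refine ⟨r1 + r2, fun x p z hmin u hu => ?_⟩
  obtain ⟨m, hm, hpm⟩ := hr1 x p z hmin
  obtain ⟨γ, hx, hγm, hγ⟩ := hd.exists_isGeod x m
  obtain ⟨γ', hm', hp', hγ'⟩ := hd.exists_isGeod m p
  have hq := hr2 x p m γ γ' hx hγm hγ hm' hp' hγ' (fun i j hi hj => by
    have h1 := hγ' 0 j (Nat.zero_le _) hj
    rw [hm'] at h1
    have h2 := hd.tri (γ i) (γ' j) m
    have h3 := hd.symm m p
    have h4 := hd.symm m (γ' j)
    omega) u hu
  rcases hq with ⟨i, hi, hui⟩ | ⟨j, hj, huj⟩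
  · refine ⟨γ i, ?_, by omega⟩
    have h1 := hγ 0 i (Nat.zero_le _) hi
    have h2 := hγ i _ hi le_rfl
    rw [hx] at h1
    rw [hγm] at h2
    have h3 := hd.tri (γ i) m z
    have h4 := hd.tri x (γ i) z
    omega
  · refine ⟨m, hm, ?_⟩
    have h1 := hγ' 0 j (Nat.zero_le _) hj
    rw [hm'] at h1
    have h2 := hd.tri u (γ' j) m
    have h3 := hd.symm m p
    have h4 := hd.symm m (γ' j)
    omega

/-- The nearest point p to z divides the side [x, y]. Each half ends at its own nearest point to z
and so follows the side from its other end to z. Stability allows u to lie on any geodesic from x to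
y. -/
theorem exists_slim {K : ℕ} (hK : LinearFilling d K) :
    ∃ r : ℕ, ∀ x y z u, d x u + d u y = d x y →
      ∃ v, d u v ≤ r ∧ (d x v + d v z = d x z ∨ d y v + d v z = d y z) := by
  obtain ⟨r1, hr1⟩ := hd.exists_near_of_projection hK
  obtain ⟨r2, hr2⟩ := hd.exists_near_of_linearFilling hK 1 0
  refine ⟨r1 + r2, fun x y z u hu => ?_⟩
  obtain ⟨p, hp, hpmin⟩ := hd.exists_nearest x y z
  obtain ⟨γ, hx, hγp, hγ⟩ := hd.exists_isGeod x p
  obtain ⟨γ', hp', hy, hγ'⟩ := hd.exists_isGeod p y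
  have hI : ∀ i, i ≤ d x p → d x (γ i) + d (γ i) p = d x p := fun i hi => by
    have h1 := hγ 0 i (Nat.zero_le _) hi
    have h2 := hγ i _ hi le_rfl
    rw [hx] at h1
    rw [hγp] at h2
    omega
  have hI' : ∀ j, j ≤ d p y → d p (γ' j) + d (γ' j) y = d p y := fun i hi => by
    have h1 := hγ' 0 i (Nat.zero_le _) hi
    have h2 := hγ' i _ hi le_rfl
    rw [hp'] at h1
    rw [hy] at h2
    omega
  have hq := hr2 x y p γ γ' hx hγp hγ hp' hy hγ' (fun i j hi hj => by
    have h1 := hI i hi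
    have h2 := hI' j hj
    have h3 := hd.tri x (γ i) (γ' j)
    have h4 := hd.tri x (γ' j) y
    omega) u hu
  rcases hq with ⟨i, hi, hui⟩ | ⟨j, hj, huj⟩
  · obtain ⟨v, hv, hv'⟩ := hr1 x p z (fun a ha => hpmin a (by
      have h1 := hd.tri a p y
      have h2 := hd.tri x a y
      omega)) (γ i) (hI i hi)
    have := hd.tri u (γ i) v
    exact ⟨v, by omega, Or.inl hv⟩
  · have h3 := hd.symm p y
    have h4 := hI' j hj
    obtain ⟨v, hv, hv'⟩ := hr1 y p z (fun a ha => hpmin a (by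
      have h1 := hd.tri x p a
      have h2 := hd.tri x a y
      have h5 := hd.symm y a
      have h6 := hd.symm p a
      omega)) (γ' j) (by
        have h1 := hd.symm p (γ' j)
        have h2 := hd.symm y (γ' j)
        omega)
    have := hd.tri u (γ' j) v
    exact ⟨v, by omega, Or.inr hv⟩

/-- A linear filling inequality implies Gromov's four-point condition. -/
theorem exists_fourPoint {K : ℕ} (hK : LinearFilling d K) : ∃ δ, 0 < δ ∧ FourPoint d δ := by
  obtain ⟨r1, hr1⟩ := hd.exists_near_projection hK
  obtain ⟨r2, hr2⟩ := hd.exists_slim hK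
  refine ⟨4 * r1 + 2 * r2 + 1, by omega, fun x z w y => ?_⟩
  obtain ⟨u, hu, humin⟩ := hd.exists_nearest x z w
  obtain ⟨m, hm, hum⟩ := hr1 x u w (fun a ha => humin a (by
      have h1 := hd.tri a u z
      have h2 := hd.tri x a z
      omega))
  obtain ⟨m', hm', hum'⟩ := hr1 z u w (fun a ha => humin a (by
      have h1 := hd.tri x u a
      have h2 := hd.tri x a z
      have h3 := hd.symm z a
      have h4 := hd.symm u a
      have h5 := hd.symm z u
      omega))
  have hc1 := hd.tri x m u
  have hc2 := hd.tri u m w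
  have hc3 := hd.tri z m' u
  have hc4 := hd.tri u m' w
  have s1 := hd.symm u m
  have s2 := hd.symm u m'
  have s3 := hd.symm u z
  -- The projection u of w lies almost on geodesics from w to both ends of [x, z]; slimness of the
  -- triangle x, z, y puts it near [x, y] or [z, y], which decides the term of the maximum.
  have hwu : d x u + d u w ≤ d x w + 2 * r1 := by omega
  have hwu' : d z u + d u w ≤ d z w + 2 * r1 := by omega
  obtain ⟨v, huv, hv | hv⟩ := hr2 x z y u hu
  · have h1 := hd.tri x v w
    have h2 := hd.tri y v w
    have h3 := hd.tri v u w
    have s4 := hd.symm u v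
    have s5 := hd.symm v y
    have s6 := hd.symm w y
    have h4 : d x z + d w y ≤ d x y + d z w + (4 * r1 + 2 * r2 + 1) := by omega
    exact h4.trans (Nat.add_le_add_right (le_max_right _ _) _)
  · have h1 := hd.tri z v w
    have h2 := hd.tri y v w
    have h3 := hd.tri v u w
    have s4 := hd.symm u v
    have s5 := hd.symm v y
    have s6 := hd.symm w y
    have h4 : d x z + d w y ≤ d x w + d z y + (4 * r1 + 2 * r2 + 1) := by omega
    exact h4.trans (Nat.add_le_add_right (le_max_left _ _) _)

end IsGraphMetric

/-! ### A random walk towards a target that depends weakly on the target -/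

/-- A group with an invariant proper graph metric that satisfies the four-point condition. -/
structure HypGroup (Γ : Type*) [Group Γ] where
  d : Γ → Γ → ℕ
  graph : IsGraphMetric d
  inv : ∀ g x y, d (g * x) (g * y) = d x y
  finite_ball : ∀ x n, {y | d x y ≤ n}.Finite
  δ : ℕ
  δ_pos : 0 < δ
  four : FourPoint d δ

/-- The difference of the averages is the average of differences over independent pairs. -/
theorem sum_abs_avg_sub_avg_le {X : Type*} (s A A' : Finset X) (κ : X → X → ℝ)
    (hA : A.Nonempty) (hA' : A'.Nonempty) :
    ∑ z ∈ s, |(∑ w ∈ A, κ w z) / A.card - (∑ w ∈ A', κ w z) / A'.card|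
      ≤ (∑ q ∈ A ×ˢ A', ∑ z ∈ s, |κ q.1 z - κ q.2 z|) / (A.card * A'.card) := by
  have hc : (0 : ℝ) < A.card := by exact_mod_cast hA.card_pos
  have hc' : (0 : ℝ) < A'.card := by exact_mod_cast hA'.card_pos
  rw [Finset.sum_comm, Finset.sum_div]
  refine Finset.sum_le_sum fun z _ => ?_
  have h : (∑ w ∈ A, κ w z) / A.card - (∑ w ∈ A', κ w z) / A'.card
      = (∑ q ∈ A ×ˢ A', (κ q.1 z - κ q.2 z)) / (A.card * A'.card) := by
    rw [Finset.sum_sub_distrib, Finset.sum_product, Finset.sum_product]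
    simp only [Finset.sum_const, nsmul_eq_mul, ← Finset.mul_sum]
    field_simp
  rw [h, abs_div, abs_of_pos (mul_pos hc hc')]
  exact div_le_div_of_nonneg_right (Finset.abs_sum_le_sum_abs _ _) (mul_pos hc hc').le

theorem sum_abs_avg_sub_avg_le_of_le {X : Type*} (s A A' : Finset X) (κ : X → X → ℝ)
    (hA : A.Nonempty) (hA' : A'.Nonempty) {T : ℝ}
    (hT : ∀ w ∈ A, ∀ w' ∈ A', ∑ z ∈ s, |κ w z - κ w' z| ≤ T) :
    ∑ z ∈ s, |(∑ w ∈ A, κ w z) / A.card - (∑ w ∈ A', κ w z) / A'.card| ≤ T := by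
  have hc : (0 : ℝ) < A.card := by exact_mod_cast hA.card_pos
  have hc' : (0 : ℝ) < A'.card := by exact_mod_cast hA'.card_pos
  refine (sum_abs_avg_sub_avg_le s A A' κ hA hA').trans ?_
  rw [div_le_iff₀ (mul_pos hc hc')]
  refine (Finset.sum_le_card_nsmul _ _ T fun q hq => ?_).trans_eq ?_
  · rw [Finset.mem_product] at hq
    exact hT _ hq.1 _ hq.2
  · rw [Finset.card_product, nsmul_eq_mul]
    push_cast
    ring

/-- The pair (u, u) contributes nothing, and it has weight at least 1 / B² among all pairs. This is
the source of the contraction. -/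
theorem sum_abs_avg_sub_avg_le_of_common {X : Type*} (s A A' : Finset X) (κ : X → X → ℝ)
    {u : X} (hu : u ∈ A) (hu' : u ∈ A') {T B : ℝ} (hT0 : 0 ≤ T) (hB : (A.card : ℝ) ≤ B)
    (hB' : (A'.card : ℝ) ≤ B)
    (hT : ∀ w ∈ A, ∀ w' ∈ A', ∑ z ∈ s, |κ w z - κ w' z| ≤ T) :
    ∑ z ∈ s, |(∑ w ∈ A, κ w z) / A.card - (∑ w ∈ A', κ w z) / A'.card|
      ≤ (1 - 1 / B ^ 2) * T := by
  classical
  have hc : (0 : ℝ) < A.card := by exact_mod_cast Finset.card_pos.2 ⟨u, hu⟩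
  have hc' : (0 : ℝ) < A'.card := by exact_mod_cast Finset.card_pos.2 ⟨u, hu'⟩
  refine (sum_abs_avg_sub_avg_le s A A' κ ⟨u, hu⟩ ⟨u, hu'⟩).trans ?_
  have hmem : (u, u) ∈ A ×ˢ A' := Finset.mem_product.2 ⟨hu, hu'⟩
  have h1 : ∑ q ∈ A ×ˢ A', ∑ z ∈ s, |κ q.1 z - κ q.2 z| ≤ (A.card * A'.card - 1) * T := by
    rw [← Finset.sum_erase_add _ _ hmem]
    simp only [sub_self, abs_zero, Finset.sum_const_zero, add_zero]
    refine (Finset.sum_le_card_nsmul _ _ T fun q hq => ?_).trans_eq ?_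
    · have := Finset.mem_product.1 (Finset.mem_of_mem_erase hq)
      exact hT _ this.1 _ this.2
    · rw [Finset.card_erase_of_mem hmem, Finset.card_product, nsmul_eq_mul,
        Nat.cast_sub (Nat.mul_pos (Finset.card_pos.2 ⟨u, hu⟩) (Finset.card_pos.2 ⟨u, hu'⟩))]
      push_cast
      ring
  have h2 : (A.card : ℝ) * A'.card ≤ B ^ 2 := by
    rw [sq]; exact mul_le_mul hB hB' hc'.le (hc.le.trans hB)
  have h3 : 1 / B ^ 2 ≤ 1 / ((A.card : ℝ) * A'.card) :=
    one_div_le_one_div_of_le (mul_pos hc hc') h2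
  calc _ ≤ ((A.card * A'.card - 1) * T) / (A.card * A'.card) :=
        div_le_div_of_nonneg_right h1 (mul_pos hc hc').le
    _ = (1 - 1 / ((A.card : ℝ) * A'.card)) * T := by field_simp
    _ ≤ _ := mul_le_mul_of_nonneg_right (by linarith) hT0

/-! ### The transition kernel and its dependence on the target -/

namespace HypGroup

variable {Γ : Type*} [Group Γ] (H : HypGroup Γ)

noncomputable def ball (x : Γ) (n : ℕ) : Finset Γ := (H.finite_ball x n).toFinset

@[simp] theorem mem_ball {x y : Γ} {n : ℕ} : y ∈ H.ball x n ↔ H.d x y ≤ n := by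
  simp [ball]

theorem ball_mul [DecidableEq Γ] (g x : Γ) (n : ℕ) :
    H.ball (g * x) n = (H.ball x n).image (g * ·) := by
  ext y
  simp only [mem_ball, Finset.mem_image]
  constructor
  · intro h
    refine ⟨g⁻¹ * y, ?_, by simp⟩
    rwa [← H.inv g, mul_inv_cancel_left]
  · rintro ⟨z, hz, rfl⟩
    rwa [H.inv]

theorem card_ball (x : Γ) (n : ℕ) : (H.ball x n).card = (H.ball 1 n).card := by
  classical
  have := H.ball_mul x 1 n
  rw [mul_one] at this
  rw [this, Finset.card_image_of_injective _ (mul_right_injective x)]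

/-- The distance between successive levels of the flow towards a point. -/
def lev : ℕ := 200 * H.δ

theorem lev_pos : 0 < H.lev := Nat.mul_pos (by norm_num) H.δ_pos

open Classical in
/-- The possible steps from `y` towards `v`. -/
noncomputable def steps (y v : Γ) : Finset Γ :=
  {z ∈ H.ball y (100 * H.δ) | 20 * H.δ ≤ H.d y z ∧ H.d y z + H.d z v ≤ H.d y v + 3 * H.δ}

open Classical in
/-- The points of the next lower level about `y` that are near a geodesic from `y` to `x`. -/
noncomputable def lower (y x : Γ) : Finset Γ :=
  {v ∈ H.ball x (2 * H.lev) | H.d y v = H.lev * ((H.d y x - 1) / H.lev) ∧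
    H.d y v + H.d v x ≤ H.d y x + H.δ}

theorem mem_steps {y v z : Γ} : z ∈ H.steps y v ↔ H.d y z ≤ 100 * H.δ ∧ 20 * H.δ ≤ H.d y z ∧
    H.d y z + H.d z v ≤ H.d y v + 3 * H.δ := by
  simp [steps]

theorem mem_lower {y x v : Γ} : v ∈ H.lower y x ↔ H.d x v ≤ 2 * H.lev ∧
    H.d y v = H.lev * ((H.d y x - 1) / H.lev) ∧ H.d y v + H.d v x ≤ H.d y x + H.δ := by
  simp [lower]

theorem level_lt {n : ℕ} (hn : 0 < n) : H.lev * ((n - 1) / H.lev) < n ∧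
    n ≤ H.lev * ((n - 1) / H.lev) + H.lev := by
  have h1 := Nat.div_add_mod (n - 1) H.lev
  have h2 := Nat.mod_lt (n - 1) H.lev_pos
  omega

theorem le_level {n J : ℕ} (hn : J * H.lev < n) : J * H.lev ≤ H.lev * ((n - 1) / H.lev) := by
  rw [mul_comm J]
  refine Nat.mul_le_mul_left _ ((Nat.le_div_iff_mul_le H.lev_pos).2 ?_)
  omega

theorem lower_lt {y x w : Γ} (hx : 0 < H.d y x) (hw : w ∈ H.lower y x) : H.d y w < H.d y x := by
  rw [(H.mem_lower.1 hw).2.1]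
  exact (H.level_lt hx).1

theorem lower_of_geodesic {y x u : Γ} (hx : 0 < H.d y x)
    (hu : H.d y u = H.lev * ((H.d y x - 1) / H.lev)) (hux : H.d y u + H.d u x ≤ H.d y x + H.δ) :
    u ∈ H.lower y x := by
  refine H.mem_lower.2 ⟨?_, hu, hux⟩
  have h1 := H.level_lt hx
  have h2 := H.graph.symm x u
  have h3 : H.δ ≤ H.lev := by unfold lev; omega
  omega

theorem lower_nonempty {y x : Γ} (hx : 0 < H.d y x) : (H.lower y x).Nonempty := by
  obtain ⟨u, hu, hux⟩ := H.graph.between y x _ (H.level_lt hx).1.le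
  exact ⟨u, H.lower_of_geodesic hx hu (by omega)⟩

open Classical in
/-- The probability of a step from `y` to `z` when walking towards `x`. -/
noncomputable def kernel (y x z : Γ) : ℝ :=
  if h : H.d y x ≤ H.lev then (if z ∈ H.steps y x then 1 / ((H.steps y x).card : ℝ) else 0)
  else (∑ w ∈ (H.lower y x).attach, kernel y w.1 z) / ((H.lower y x).card : ℝ)
termination_by H.d y x
decreasing_by exact H.lower_lt (by have := H.lev_pos; omega) w.2

open Classical in
theorem kernel_of_le {y x : Γ} (h : H.d y x ≤ H.lev) (z : Γ) :
    H.kernel y x z = if z ∈ H.steps y x then 1 / ((H.steps y x).card : ℝ) else 0 := by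
  rw [kernel, dif_pos h]

theorem kernel_of_lt {y x : Γ} (h : H.lev < H.d y x) (z : Γ) :
    H.kernel y x z = (∑ w ∈ H.lower y x, H.kernel y w z) / ((H.lower y x).card : ℝ) := by
  rw [kernel, dif_neg (by omega), Finset.sum_attach (H.lower y x) fun w => H.kernel y w z]

theorem steps_mul (g y v z : Γ) : g * z ∈ H.steps (g * y) (g * v) ↔ z ∈ H.steps y v := by
  simp only [mem_steps, H.inv]

theorem lower_mul (g y x v : Γ) : g * v ∈ H.lower (g * y) (g * x) ↔ v ∈ H.lower y x := by
  simp only [mem_lower, H.inv]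

theorem map_lower (g y x : Γ) :
    H.lower (g * y) (g * x) = (H.lower y x).map ⟨(g * ·), mul_right_injective g⟩ := by
  ext v
  rw [Finset.mem_map]
  constructor
  · intro h
    refine ⟨g⁻¹ * v, ?_, by simp⟩
    rw [← H.lower_mul g, mul_inv_cancel_left]
    exact h
  · rintro ⟨w, hw, rfl⟩
    exact (H.lower_mul g y x w).2 hw

theorem map_steps (g y x : Γ) :
    H.steps (g * y) (g * x) = (H.steps y x).map ⟨(g * ·), mul_right_injective g⟩ := by
  ext v
  rw [Finset.mem_map]
  constructor
  · intro h
    refine ⟨g⁻¹ * v, ?_, by simp⟩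
    rw [← H.steps_mul g, mul_inv_cancel_left]
    exact h
  · rintro ⟨w, hw, rfl⟩
    exact (H.steps_mul g y x w).2 hw

theorem kernel_mul (g y x z : Γ) : H.kernel (g * y) (g * x) (g * z) = H.kernel y x z := by
  induction hn : H.d y x using Nat.strong_induction_on generalizing x with
  | _ n ih =>
    subst hn
    by_cases h : H.d y x ≤ H.lev
    · have hiff := H.steps_mul g y x z
      rw [H.kernel_of_le h, H.kernel_of_le (y := g * y) (x := g * x) (by rwa [H.inv])]
      by_cases hz : z ∈ H.steps y x
      · rw [if_pos hz, if_pos (hiff.2 hz), H.map_steps, Finset.card_map]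
      · rw [if_neg hz, if_neg (mt hiff.1 hz)]
    · rw [H.kernel_of_lt (y := y) (x := x) (by omega),
        H.kernel_of_lt (y := g * y) (x := g * x) (by rw [H.inv]; omega), H.map_lower,
        Finset.card_map, Finset.sum_map]
      congr 1
      refine Finset.sum_congr rfl fun w hw => ?_
      exact ih _ (H.lower_lt (by have := H.lev_pos; omega) hw) w rfl

theorem kernel_nonneg (y x z : Γ) : 0 ≤ H.kernel y x z := by
  induction hn : H.d y x using Nat.strong_induction_on generalizing x with
  | _ n ih =>
    subst hn
    by_cases h : H.d y x ≤ H.lev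
    · rw [H.kernel_of_le h]
      split_ifs <;> positivity
    · rw [H.kernel_of_lt (by omega)]
      refine div_nonneg (Finset.sum_nonneg fun w hw => ?_) (by positivity)
      exact ih _ (H.lower_lt (by have := H.lev_pos; omega) hw) w rfl

/-- An induction principle for the flow from `x` down to the level `J` about `y`: it reaches that
level near the geodesics from `y` to `x`. -/
theorem flow_induction {y x : Γ} {J : ℕ} (hJ : 1 ≤ J) (hx : J * H.lev ≤ H.d y x) (C : Γ → Prop)
    (hbase : ∀ v, H.d y v = J * H.lev → H.d y v + H.d v x ≤ H.d y x + 2 * H.δ → C v)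
    (havg : ∀ v, J * H.lev < H.d y v → (∀ w ∈ H.lower y v, C w) → C v) : C x := by
  have hδL : 100 * H.δ ≤ H.lev := by unfold lev; omega
  have hLJ : H.lev ≤ J * H.lev := Nat.le_mul_of_pos_left _ hJ
  have hLpos := H.lev_pos
  have key : ∀ n v, H.d y v = n → H.lev ∣ H.d y v → J * H.lev ≤ H.d y v →
      H.d y v + H.d v x ≤ H.d y x + 2 * H.δ → C v := by
    intro n
    induction n using Nat.strong_induction_on with
    | _ n ih =>
      intro v hn hdvd hJv hv
      rcases eq_or_lt_of_le hJv with h | h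
      · exact hbase v h.symm hv
      · refine havg v h fun w hw => ?_
        have hlt := H.lower_lt (by omega) hw
        obtain ⟨-, hw1, hw2⟩ := H.mem_lower.1 hw
        have hdvd' : H.lev ∣ H.d y w := by rw [hw1]; exact Dvd.intro _ rfl
        have hgap : H.lev ≤ H.d y v - H.d y w :=
          Nat.le_of_dvd (by omega) (Nat.dvd_sub hdvd hdvd')
        refine ih _ (by omega) w rfl hdvd' (by rw [hw1]; exact H.le_level h) ?_
        -- The error 2δ does not accumulate: the levels of v and w differ by much more than δ, which
        -- excludes the growing alternative of the four-point condition and leaves the defect δ of w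
        -- relative to v plus one further δ.
        have h4 := H.four w x v y
        have s1 := H.graph.symm w v
        have s2 := H.graph.symm x y
        have s3 := H.graph.symm w y
        have s4 := H.graph.symm x v
        have s5 := H.graph.symm y v
        omega
  rcases eq_or_lt_of_le hx with h | h
  · exact hbase x h.symm (by simp [H.graph.self])
  · refine havg x h fun w hw => ?_
    obtain ⟨-, hw1, hw2⟩ := H.mem_lower.1 hw
    exact key _ w rfl (by rw [hw1]; exact Dvd.intro _ rfl) (by rw [hw1]; exact H.le_level h)
      (by omega)

theorem steps_nonempty {y v : Γ} (h : H.d y v = H.lev) : (H.steps y v).Nonempty := by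
  obtain ⟨u, hu, huv⟩ := H.graph.between y v (20 * H.δ) (by rw [h]; unfold lev; omega)
  exact ⟨u, H.mem_steps.2 ⟨by omega, by omega, by omega⟩⟩

theorem sum_kernel {y x : Γ} (hx : H.lev ≤ H.d y x) :
    ∑ z ∈ H.ball y (100 * H.δ), H.kernel y x z = 1 := by
  classical
  refine H.flow_induction le_rfl (by simpa using hx)
    (fun v => ∑ z ∈ H.ball y (100 * H.δ), H.kernel y v z = 1) (fun v hv _ => ?_)
    (fun v hv ih => ?_)
  · rw [one_mul] at hv
    have hne := H.steps_nonempty hv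
    have hc : ((H.steps y v).card : ℝ) ≠ 0 := by exact_mod_cast hne.card_pos.ne'
    have hsub : H.steps y v ⊆ H.ball y (100 * H.δ) := fun z hz =>
      H.mem_ball.2 (H.mem_steps.1 hz).1
    simp only [H.kernel_of_le hv.le]
    rw [← Finset.sum_filter, Finset.filter_mem_eq_inter, Finset.inter_eq_right.2 hsub,
      Finset.sum_const, nsmul_eq_mul]
    field_simp
  · rw [one_mul] at hv
    have hne := H.lower_nonempty (y := y) (x := v) (by omega)
    have hc : ((H.lower y v).card : ℝ) ≠ 0 := by exact_mod_cast hne.card_pos.ne'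
    simp only [H.kernel_of_lt hv]
    rw [← Finset.sum_div, Finset.sum_comm, Finset.sum_congr rfl ih, Finset.sum_const, nsmul_eq_mul,
      mul_one, div_self hc]

/-- The defect 5δ is the 3δ allowed in `steps` plus the 2δ of the flow. As steps have length at
least 20δ, each one advances by at least 15δ. -/
theorem kernel_support {y x z : Γ} (hx : H.lev ≤ H.d y x) (hz : H.kernel y x z ≠ 0) :
    20 * H.δ ≤ H.d y z ∧ H.d y z ≤ 100 * H.δ ∧ H.d y z + H.d z x ≤ H.d y x + 5 * H.δ := by
  refine H.flow_induction le_rfl (by simpa using hx)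
    (fun v => H.kernel y v z ≠ 0 → 20 * H.δ ≤ H.d y z ∧ H.d y z ≤ 100 * H.δ ∧
      H.d y z + H.d z x ≤ H.d y x + 5 * H.δ) (fun v hv hvx hne => ?_) (fun v hv ih hne => ?_) hz
  · rw [one_mul] at hv
    rw [H.kernel_of_le hv.le] at hne
    have hmem : z ∈ H.steps y v := by
      by_contra hcon
      rw [if_neg hcon] at hne
      exact hne rfl
    rw [mem_steps] at hmem
    have := H.graph.tri z v x
    omega
  · rw [one_mul] at hv
    rw [H.kernel_of_lt hv] at hne
    have : ∃ w ∈ H.lower y v, H.kernel y w z ≠ 0 := by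
      by_contra hcon
      push Not at hcon
      rw [Finset.sum_eq_zero hcon, zero_div] at hne
      exact hne rfl
    obtain ⟨w, hw, hwz⟩ := this
    exact ih w hw hwz

/-- A lower bound for the probability of the steps along geodesics. -/
noncomputable def hitProb : ℝ := 1 / ((H.ball 1 (100 * H.δ)).card : ℝ)

theorem hitProb_pos : 0 < H.hitProb := by
  refine one_div_pos.2 ?_
  have : (1 : Γ) ∈ H.ball 1 (100 * H.δ) := by simp [H.graph.self]
  exact_mod_cast Finset.card_pos.2 ⟨_, this⟩

theorem hitProb_le_one : H.hitProb ≤ 1 := by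
  have : (1 : Γ) ∈ H.ball 1 (100 * H.δ) := by simp [H.graph.self]
  have h : (1 : ℝ) ≤ (H.ball 1 (100 * H.δ)).card := by exact_mod_cast Finset.card_pos.2 ⟨_, this⟩
  unfold hitProb
  rw [div_le_one (by linarith)]
  exact h

/-- By the four-point condition u is an admissible step towards every point at which the flow from x
reaches the lowest level; there the choice is uniform in a subset of a ball, and averaging keeps the
lower bound. -/
theorem hitProb_le_kernel {y x u : Γ} (hx : H.lev ≤ H.d y x) (h1 : 20 * H.δ ≤ H.d y u)
    (h2 : H.d y u ≤ 100 * H.δ) (h3 : H.d y u + H.d u x ≤ H.d y x + H.δ) :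
    H.hitProb ≤ H.kernel y x u := by
  refine H.flow_induction le_rfl (by simpa using hx)
    (fun v => H.hitProb ≤ H.kernel y v u) (fun v hv hvx => ?_) (fun v hv ih => ?_)
  · rw [one_mul] at hv
    have hmem : u ∈ H.steps y v := by
      refine H.mem_steps.2 ⟨h2, h1, ?_⟩
      have h4 := H.four u v y x
      have s1 := H.graph.symm u y
      have s2 := H.graph.symm v y
      have hL : H.lev = 200 * H.δ := rfl
      omega
    have hsub : H.steps y v ⊆ H.ball y (100 * H.δ) := fun z hz =>
      H.mem_ball.2 (H.mem_steps.1 hz).1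
    rw [H.kernel_of_le hv.le, if_pos hmem, hitProb, ← H.card_ball y]
    refine one_div_le_one_div_of_le ?_ ?_
    · exact_mod_cast Finset.card_pos.2 ⟨u, hmem⟩
    · exact_mod_cast Finset.card_le_card hsub
  · rw [one_mul] at hv
    have hne := H.lower_nonempty (y := y) (x := v) (by omega)
    have hc : (0 : ℝ) < (H.lower y v).card := by exact_mod_cast hne.card_pos
    rw [H.kernel_of_lt hv, le_div_iff₀ hc, mul_comm, ← nsmul_eq_mul]
    exact Finset.card_nsmul_le_sum _ _ _ ih

/-- The rate at which the walk forgets its target. -/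
noncomputable def rate : ℝ := 1 - 1 / ((H.ball 1 (2 * H.lev)).card : ℝ) ^ 2

theorem rate_nonneg : 0 ≤ H.rate := by
  have : (1 : Γ) ∈ H.ball 1 (2 * H.lev) := by simp [H.graph.self]
  have h : (1 : ℝ) ≤ (H.ball 1 (2 * H.lev)).card := by exact_mod_cast Finset.card_pos.2 ⟨_, this⟩
  unfold rate
  rw [sub_nonneg, div_le_one (by positivity)]
  exact one_le_pow₀ h

theorem rate_lt_one : H.rate < 1 := by
  have : (1 : Γ) ∈ H.ball 1 (2 * H.lev) := by simp [H.graph.self]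
  have h : (0 : ℝ) < (H.ball 1 (2 * H.lev)).card := by exact_mod_cast Finset.card_pos.2 ⟨_, this⟩
  unfold rate
  have : 0 < 1 / ((H.ball 1 (2 * H.lev)).card : ℝ) ^ 2 := by positivity
  linarith

theorem card_lower_le (y x : Γ) : ((H.lower y x).card : ℝ) ≤ (H.ball 1 (2 * H.lev)).card := by
  rw [← H.card_ball x]
  exact_mod_cast Finset.card_le_card fun v hv => H.mem_ball.2 (H.mem_lower.1 hv).1

theorem sum_abs_kernel_sub_le_two {y x x' : Γ} (hx : H.lev ≤ H.d y x) (hx' : H.lev ≤ H.d y x') :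
    ∑ z ∈ H.ball y (100 * H.δ), |H.kernel y x z - H.kernel y x' z| ≤ 2 := by
  calc _ ≤ ∑ z ∈ H.ball y (100 * H.δ), (H.kernel y x z + H.kernel y x' z) :=
        Finset.sum_le_sum fun z _ => by
          have h1 := H.kernel_nonneg y x z
          have h2 := H.kernel_nonneg y x' z
          rw [abs_le]
          constructor <;> linarith
    _ = 2 := by rw [Finset.sum_add_distrib, H.sum_kernel hx, H.sum_kernel hx']; norm_num

theorem sum_abs_kernel_sub_le_of_level (y : Γ) (k : ℕ) :
    ∀ v v', H.d y v = (k + 1) * H.lev → H.d y v' = (k + 1) * H.lev → H.d v v' ≤ 2 * H.lev →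
      ∑ z ∈ H.ball y (100 * H.δ), |H.kernel y v z - H.kernel y v' z| ≤ H.rate ^ k * 2 := by
  have hδL : 100 * H.δ ≤ H.lev := by unfold lev; omega
  have hLpos := H.lev_pos
  induction k with
  | zero =>
    intro v v' hv hv' _
    rw [pow_zero, one_mul]
    exact H.sum_abs_kernel_sub_le_two (by omega) (by omega)
  | succ k ih =>
    intro v v' hv hv' hvv
    have hexp : (k + 1 + 1) * H.lev = (k + 1) * H.lev + H.lev := by ring
    have hkL : H.lev ≤ (k + 1) * H.lev := Nat.le_mul_of_pos_left _ (by omega)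
    have hlevel : H.lev * (((k + 1 + 1) * H.lev - 1) / H.lev) = (k + 1) * H.lev := by
      have h1 := H.level_lt (n := (k + 1 + 1) * H.lev) (by omega)
      have h2 := H.le_level (n := (k + 1 + 1) * H.lev) (J := k + 1) (by omega)
      have h3 : H.lev * (((k + 1 + 1) * H.lev - 1) / H.lev) < H.lev * (k + 1 + 1) := by
        rw [mul_comm H.lev (k + 1 + 1)]; exact h1.1
      have h4 := Nat.lt_of_mul_lt_mul_left h3
      have h5 : H.lev * (((k + 1 + 1) * H.lev - 1) / H.lev) ≤ H.lev * (k + 1) :=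
        Nat.mul_le_mul_left _ (by omega)
      rw [mul_comm H.lev (k + 1)] at h5
      omega
    -- A point of a geodesic to v is a common lower point of v and v', since these are within two
    -- levels of each other; the lower points of v and v' are again within that distance, so the
    -- contraction repeats at each level.
    obtain ⟨u, hu, huv⟩ := H.graph.between y v ((k + 1) * H.lev) (by omega)
    have hmem : u ∈ H.lower y v :=
      H.lower_of_geodesic (by omega) (by rw [hv, hlevel, hu]) (by omega)
    have hmem' : u ∈ H.lower y v' := by
      refine H.lower_of_geodesic (by omega) (by rw [hv', hlevel, hu]) ?_
      have h4 := H.four u v' y v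
      have s1 := H.graph.symm u y
      have s2 := H.graph.symm v' y
      have s3 := H.graph.symm v' v
      omega
    simp only [H.kernel_of_lt (show H.lev < H.d y v by omega),
      H.kernel_of_lt (show H.lev < H.d y v' by omega)]
    have hrate : H.rate ^ (k + 1) * 2
        = (1 - 1 / ((H.ball 1 (2 * H.lev)).card : ℝ) ^ 2) * (H.rate ^ k * 2) := by
      rw [← rate]; ring
    rw [hrate]
    refine sum_abs_avg_sub_avg_le_of_common _ _ _ _ hmem hmem'
      (mul_nonneg (pow_nonneg H.rate_nonneg _) (by norm_num)) (H.card_lower_le y v)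
      (H.card_lower_le y v') fun w hw w' hw' => ?_
    obtain ⟨-, hw1, hw2⟩ := H.mem_lower.1 hw
    obtain ⟨-, hw1', hw2'⟩ := H.mem_lower.1 hw'
    rw [hv, hlevel] at hw1
    rw [hv', hlevel] at hw1'
    refine ih w w' hw1 hw1' ?_
    have h4 := H.four w' v y v'
    have h5 := H.four w w' y v
    have s1 := H.graph.symm w' y
    have s2 := H.graph.symm v y
    have s3 := H.graph.symm w y
    have s4 := H.graph.symm v v'
    omega

/-- The walk from `y` depends exponentially little on the part of the target beyond `v`. -/
theorem sum_abs_kernel_sub_le {y v x x' : Γ} {k : ℕ} (hv : H.d y v = (k + 1) * H.lev)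
    (hx : (k + 1) * H.lev ≤ H.d y x) (hx' : (k + 1) * H.lev ≤ H.d y x')
    (hvx : H.d y v + H.d v x ≤ H.d y x + 100 * H.δ)
    (hvx' : H.d y v + H.d v x' ≤ H.d y x' + 100 * H.δ) :
    ∑ z ∈ H.ball y (100 * H.δ), |H.kernel y x z - H.kernel y x' z| ≤ H.rate ^ k * 4 := by
  have hδL : 200 * H.δ ≤ H.lev := by unfold lev; omega
  have hkL : H.lev ≤ (k + 1) * H.lev := Nat.le_mul_of_pos_left _ (by omega)
  have key : ∀ x, (k + 1) * H.lev ≤ H.d y x → H.d y v + H.d v x ≤ H.d y x + 100 * H.δ →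
      ∑ z ∈ H.ball y (100 * H.δ), |H.kernel y x z - H.kernel y v z| ≤ H.rate ^ k * 2 := by
    intro x hx hvx
    refine H.flow_induction (J := k + 1) (by omega) hx
      (fun w => ∑ z ∈ H.ball y (100 * H.δ), |H.kernel y w z - H.kernel y v z| ≤ H.rate ^ k * 2)
      (fun w hw hwx => ?_) (fun w hw ih => ?_)
    · refine H.sum_abs_kernel_sub_le_of_level y k w v hw hv ?_
      have h4 := H.four w v y x
      have s1 := H.graph.symm w y
      have s2 := H.graph.symm v y
      omega
    · have h := sum_abs_avg_sub_avg_le_of_le (H.ball y (100 * H.δ)) (H.lower y w) {v}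
        (H.kernel y) (H.lower_nonempty (by have := H.lev_pos; omega)) (Finset.singleton_nonempty v)
        (T := H.rate ^ k * 2) (fun u hu u' hu' => by
          rw [Finset.mem_singleton] at hu'
          subst hu'
          exact ih u hu)
      simp only [Finset.sum_singleton, Finset.card_singleton, Nat.cast_one, div_one] at h
      simp only [H.kernel_of_lt (show H.lev < H.d y w by omega)]
      exact h
  calc _ ≤ ∑ z ∈ H.ball y (100 * H.δ), (|H.kernel y x z - H.kernel y v z|
          + |H.kernel y x' z - H.kernel y v z|) := Finset.sum_le_sum fun z _ => by
            rw [← abs_neg (H.kernel y x' z - H.kernel y v z)]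
            refine le_trans (le_of_eq ?_) (abs_add_le _ _)
            congr 1
            ring
    _ ≤ H.rate ^ k * 2 + H.rate ^ k * 2 := by
      rw [Finset.sum_add_distrib]
      exact add_le_add (key x hx hvx) (key x' hx' hvx')
    _ = _ := by ring

end HypGroup

/-! ### Cocycles that have mean zero along the walk are bounded -/

namespace HypGroup

variable {Γ : Type*} [Group Γ] (H : HypGroup Γ)

/-- Cocycles for which the triangles spanned by a step of the walk have mean zero. -/
structure IsBalanced (𝕜 : Type*) [RCLike 𝕜] {V : Type*} [NormedAddCommGroup V] [NormedSpace 𝕜 V]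
    (C : Γ → Γ → Γ → V) : Prop where
  cocycle : ∀ x y z t, C y z t - C x z t + C x y t - C x y z = 0
  norm_mul : ∀ g x y z, ‖C (g * x) (g * y) (g * z)‖ = ‖C x y z‖
  mean : ∀ x y, H.lev < H.d y x →
    ∑ z ∈ H.ball y (100 * H.δ), (H.kernel y x z : 𝕜) • C x z y = 0
  anti : ∀ x y y', H.d y y' ≤ H.lev → C x y y' = - C x y' y
  self : ∀ x y, C x y y = 0

/-- Up to translation there are finitely many triangles of bounded size. -/
theorem exists_local_bound {V : Type*} [NormedAddCommGroup V] {C : Γ → Γ → Γ → V}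
    (hC : ∀ g x y z, ‖C (g * x) (g * y) (g * z)‖ = ‖C x y z‖) (n : ℕ) :
    ∃ K : ℝ, 0 ≤ K ∧ ∀ x y z, H.d x y ≤ n → H.d x z ≤ n → ‖C x y z‖ ≤ K := by
  obtain ⟨K, hK⟩ := (((H.finite_ball 1 n).prod (H.finite_ball 1 n)).image
    fun q => ‖C 1 q.1 q.2‖).bddAbove
  refine ⟨|K|, abs_nonneg K, fun x y z hy hz => ?_⟩
  rw [← hC x⁻¹, inv_mul_cancel]
  refine (hK ⟨(x⁻¹ * y, x⁻¹ * z), ⟨?_, ?_⟩, rfl⟩).trans (le_abs_self K)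
  · change H.d 1 (x⁻¹ * y) ≤ n
    rwa [← H.inv x, mul_one, mul_inv_cancel_left]
  · change H.d 1 (x⁻¹ * z) ≤ n
    rwa [← H.inv x, mul_one, mul_inv_cancel_left]

/-- Moving the farther point of a pair towards the target keeps the pair close. -/
theorem dist_step_le {x y y' z : Γ} (hyy : H.d y y' ≤ 101 * H.δ) (hfar : H.d y' x ≤ H.d y x)
    (h1 : 20 * H.δ ≤ H.d y z) (h2 : H.d y z ≤ 100 * H.δ)
    (h3 : H.d y z + H.d z x ≤ H.d y x + 5 * H.δ) : H.d z y' ≤ 101 * H.δ := by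
  have h4 := H.four z y' y x
  have s1 := H.graph.symm z y
  have s2 := H.graph.symm y' y
  omega

theorem dist_geodesic_le {x y y' u : Γ} (hu : H.d y u + H.d u x = H.d y x) :
    H.d u y' + H.d y x ≤ max (H.d y u + H.d y' x) (H.d u x + H.d y y') + H.δ := by
  have h4 := H.four u y' y x
  have s1 := H.graph.symm u y
  have s2 := H.graph.symm y' y
  omega

namespace IsBalanced

variable {H} {𝕜 : Type*} [RCLike 𝕜] {V : Type*} [NormedAddCommGroup V] [NormedSpace 𝕜 V]
  {C : Γ → Γ → Γ → V} (hC : H.IsBalanced 𝕜 C)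

theorem sum_kernel_smul {y x : Γ} (hx : H.lev < H.d y x) (v : V) :
    ∑ z ∈ H.ball y (100 * H.δ), (H.kernel y x z : 𝕜) • v = v := by
  rw [← Finset.sum_smul, ← RCLike.ofReal_sum, H.sum_kernel hx.le, RCLike.ofReal_one, one_smul]

include hC

theorem norm_symm {x y y' : Γ} (h : H.d y y' ≤ H.lev) : ‖C x y y'‖ = ‖C x y' y‖ := by
  rw [hC.anti x y y' h, norm_neg]

/-- One random step of y towards x averages the bound M over the new positions, at a local cost K. A
position u with bound improved by m lowers the average by at least `hitProb` times m. -/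
theorem norm_le_of_step {x y y' u : Γ} {K M m : ℝ}
    (hK : ∀ x y z, H.d x y ≤ 600 * H.δ → H.d x z ≤ 600 * H.δ → ‖C x y z‖ ≤ K)
    (hx : H.lev < H.d y x) (hyy : H.d y y' ≤ 101 * H.δ) (hfar : H.d y' x ≤ H.d y x)
    (hM : ∀ z, H.d z y' ≤ 101 * H.δ → H.d z x < H.d y x → ‖C x z y'‖ ≤ M)
    (hu1 : 20 * H.δ ≤ H.d y u) (hu2 : H.d y u ≤ 100 * H.δ)
    (hu3 : H.d y u + H.d u x ≤ H.d y x + H.δ) (hm : 0 ≤ m) (hu : ‖C x u y'‖ ≤ M - m) :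
    ‖C x y y'‖ ≤ M - (H.hitProb * m - K) := by
  classical
  have hδ := H.δ_pos
  set s := H.ball y (100 * H.δ)
  have hus : u ∈ s := H.mem_ball.2 hu2
  have e1 : C x y y' = ∑ z ∈ s, (H.kernel y x z : 𝕜) • (C x z y' + C z y y') := by
    have h1 : ∑ z ∈ s, (H.kernel y x z : 𝕜) • (C x z y' + C z y y')
        = ∑ z ∈ s, ((H.kernel y x z : 𝕜) • C x y y' + (H.kernel y x z : 𝕜) • C x z y) := by
      refine Finset.sum_congr rfl fun z _ => ?_
      rw [← smul_add]
      congr 1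
      have h := hC.cocycle x z y y'
      have : C x z y' + C z y y' = C x y y' + C x z y
          + (C z y y' - C x y y' + C x z y' - C x z y) := by abel
      rw [this, h, add_zero]
    rw [h1, Finset.sum_add_distrib, hC.mean x y hx, sum_kernel_smul hx, add_zero]
  have hloc : ∀ z ∈ s, ‖C z y y'‖ ≤ K := fun z hz => by
    have h1 := H.mem_ball.1 hz
    have h2 := H.graph.symm z y
    have h3 := H.graph.tri z y y'
    exact hK z y y' (by omega) (by omega)
  have hterm : ∀ z ∈ s, ‖(H.kernel y x z : 𝕜) • (C x z y' + C z y y')‖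
      ≤ H.kernel y x z * (M + K) := by
    intro z hz
    rw [norm_smul, RCLike.norm_ofReal, abs_of_nonneg (H.kernel_nonneg y x z)]
    by_cases h0 : H.kernel y x z = 0
    · rw [h0, zero_mul, zero_mul]
    · obtain ⟨h1, h2, h3⟩ := H.kernel_support hx.le h0
      refine mul_le_mul_of_nonneg_left ((norm_add_le _ _).trans (add_le_add (hM z ?_ ?_)
        (hloc z hz))) (H.kernel_nonneg y x z)
      · exact H.dist_step_le hyy hfar h1 h2 h3
      · omega
  have htermu : ‖(H.kernel y x u : 𝕜) • (C x u y' + C u y y')‖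
      ≤ H.kernel y x u * (M + K) - H.hitProb * m := by
    rw [norm_smul, RCLike.norm_ofReal, abs_of_nonneg (H.kernel_nonneg y x u)]
    have h1 := mul_le_mul_of_nonneg_left ((norm_add_le _ _).trans (add_le_add hu (hloc u hus)))
      (H.kernel_nonneg y x u)
    have h2 := mul_le_mul_of_nonneg_right (H.hitProb_le_kernel hx.le hu1 hu2 hu3) hm
    linarith
  have hsum : ∑ z ∈ s, H.kernel y x z * (M + K) = M + K := by
    rw [← Finset.sum_mul, H.sum_kernel hx.le, one_mul]
  rw [e1, ← Finset.sum_erase_add _ _ hus]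
  rw [← Finset.sum_erase_add _ _ hus] at hsum
  have h3 := Finset.sum_le_sum fun z (hz : z ∈ s.erase u) => hterm z (Finset.mem_of_mem_erase hz)
  have h4 := norm_sum_le (s.erase u) fun z => (H.kernel y x z : 𝕜) • (C x z y' + C z y y')
  have h5 := norm_add_le (∑ z ∈ s.erase u, (H.kernel y x z : 𝕜) • (C x z y' + C z y y'))
    ((H.kernel y x u : 𝕜) • (C x u y' + C u y y'))
  linarith

/-- If the lag between the points of a pair is not too large, then both points may jump to a
common point. -/
theorem norm_le_of_lag {x y y' : Γ} {K M : ℝ} (hK0 : 0 ≤ K)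
    (hK : ∀ x y z, H.d x y ≤ 600 * H.δ → H.d x z ≤ 600 * H.δ → ‖C x y z‖ ≤ K)
    (hM0 : K ≤ H.hitProb * M) (hx : 400 * H.δ ≤ H.d y x) (hyy : H.d y y' ≤ 101 * H.δ)
    (hfar : H.d y' x ≤ H.d y x) (hlag : H.d y x ≤ H.d y' x + 79 * H.δ)
    (hM : ∀ z z', H.d z z' ≤ 101 * H.δ → H.d z x + H.d z' x < H.d y x + H.d y' x →
      ‖C x z z'‖ ≤ M) :
    ‖C x y y'‖ ≤ M - (H.hitProb * (H.hitProb * M - K) - K) := by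
  have hδ := H.δ_pos
  have hL : H.lev = 200 * H.δ := rfl
  have hM1 : 0 ≤ M := nonneg_of_mul_nonneg_right (hK0.trans hM0) H.hitProb_pos
  obtain ⟨ℓ, hℓ⟩ := Nat.exists_eq_add_of_le hfar
  -- The first condition puts u within t - ℓ + δ of y', so u is almost on a geodesic from y' to x;
  -- the others keep the jumps from y and y' between 20δ and 100δ. They are compatible because ℓ ≤
  -- 79δ.
  obtain ⟨t, ht1, ht2, ht3⟩ : ∃ t, H.d y y' + ℓ ≤ 2 * t ∧ ℓ + 20 * H.δ ≤ t ∧ t ≤ 99 * H.δ :=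
    ⟨max ((H.d y y' + ℓ + 1) / 2) (ℓ + 20 * H.δ), by omega, by omega, by omega⟩
  obtain ⟨u, hu, hux⟩ := H.graph.between y x t (by omega)
  have hd1 := H.dist_geodesic_le (y' := y') hux
  have hd2 := H.graph.tri y' u x
  have hs := H.graph.symm u y'
  refine hC.norm_le_of_step hK (by omega) hyy hfar (fun z hz hzx => hM z y' hz (by omega))
    (by omega) (by omega) (by omega) (by linarith) (u := u) ?_
  rw [hC.norm_symm (by omega)]
  refine hC.norm_le_of_step (u := u) hK (by omega) (by omega) (by omega)
    (fun z hz hzx => hM z u hz (by omega)) (by omega) (by omega) (by omega) hM1 ?_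
  rw [hC.self, norm_zero, sub_self]

/-- Balanced cocycles are bounded on triangles with a short side opposite to the first vertex. -/
theorem exists_bound_short : ∃ M : ℝ, ∀ x y y', H.d y y' ≤ 101 * H.δ → ‖C x y y'‖ ≤ M := by
  have hδ := H.δ_pos
  have hL : H.lev = 200 * H.δ := rfl
  obtain ⟨K, hK0, hK⟩ := H.exists_local_bound hC.norm_mul (600 * H.δ)
  set q := H.hitProb
  have hq : 0 < q := H.hitProb_pos
  have hq1 : q ≤ 1 := H.hitProb_le_one
  -- At most three favourable jumps bring the two points together, and q³M = 3K pays for the three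
  -- local errors.
  set M := 3 * K / q ^ 3
  have hqM : q ^ 3 * M = 3 * K := by simp only [M]; field_simp
  have hM0 : 0 ≤ M := by positivity
  have hq2M : 3 * K ≤ q ^ 2 * M := by
    rw [← hqM]
    exact mul_le_mul_of_nonneg_right (pow_le_pow_of_le_one hq.le hq1 (by norm_num)) hM0
  have hq1M : 3 * K ≤ q * M := by
    refine hq2M.trans (mul_le_mul_of_nonneg_right ?_ hM0)
    simpa using pow_le_pow_of_le_one hq.le hq1 (show 1 ≤ 2 by norm_num)
  have hKM : K ≤ M := by
    have : q * M ≤ 1 * M := mul_le_mul_of_nonneg_right hq1 hM0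
    linarith
  have hqK : q * K ≤ K := by
    have := mul_le_mul_of_nonneg_right hq1 hK0
    linarith
  refine ⟨M, fun x => ?_⟩
  have key : ∀ n y y', H.d y x + H.d y' x = n → H.d y y' ≤ 101 * H.δ → ‖C x y y'‖ ≤ M := by
    intro n
    induction n using Nat.strong_induction_on with
    | _ n ih =>
      have main : ∀ y y', H.d y x + H.d y' x = n → H.d y y' ≤ 101 * H.δ →
          H.d y' x ≤ H.d y x → ‖C x y y'‖ ≤ M := by
        intro y y' hn hyy hfar
        by_cases hbase : H.d y x ≤ 600 * H.δ
        · have s1 := H.graph.symm y x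
          have s2 := H.graph.symm y' x
          exact (hK x y y' (by omega) (by omega)).trans hKM
        · by_cases hlag : H.d y x ≤ H.d y' x + 79 * H.δ
          · have := hC.norm_le_of_lag hK0 hK (M := M) (by linarith) (by omega) hyy hfar hlag
              (fun z z' hz hlt => ih _ (by omega) z z' rfl hz)
            nlinarith
          -- The lag is at most d(y, y') ≤ 101δ. A jump of 40δ by the farther point brings it down
          -- to at most 61δ without reversing the order, and then the two jumps of `norm_le_of_lag`
          -- apply.
          · obtain ⟨u, hu, hux⟩ := H.graph.between y x (40 * H.δ) (by omega)
            have hd1 := H.dist_geodesic_le (y' := y') hux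
            have htri := H.graph.tri y y' x
            have h1 := hC.norm_le_of_lag (x := x) (y := u) (y' := y') hK0 hK (M := M)
              (by linarith) (by omega) (by omega) (by omega) (by omega)
              (fun z z' hz hlt => ih _ (by omega) z z' rfl hz)
            have h2 := hC.norm_le_of_step hK (by omega) hyy hfar
              (fun z hz hzx => ih _ (by omega) z y' rfl hz) (by omega) (by omega) (by omega)
              (m := q * (q * M - K) - K) (u := u) (by nlinarith) h1
            refine h2.trans ?_
            have : q * (q * (q * M - K) - K) - K = q ^ 3 * M - q * (q * K) - q * K - K := by ring
            have h3 : q * (q * K) ≤ K := (mul_le_mul_of_nonneg_left hqK hq.le).trans hqK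
            linarith
      intro y y' hn hyy
      rcases le_total (H.d y' x) (H.d y x) with h | h
      · exact main y y' hn hyy h
      · rw [hC.norm_symm (by omega)]
        exact main y' y (by omega) (by rwa [H.graph.symm]) h
  intro y y' h
  exact key _ y y' rfl h

theorem exists_bound_of_dist_le (r : ℕ) :
    ∃ M : ℝ, ∀ x y y', H.d y y' ≤ r → ‖C x y y'‖ ≤ M := by
  have hδ := H.δ_pos
  obtain ⟨M1, hM1⟩ := hC.exists_bound_short
  induction r with
  | zero => exact ⟨M1, fun x y y' h => hM1 x y y' (by omega)⟩
  | succ r ih =>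
    obtain ⟨M, hM⟩ := ih
    refine ⟨M + M1 + max M M1 + M1, fun x y y' h => ?_⟩
    have hM10 : 0 ≤ M1 := (norm_nonneg _).trans (hM1 y y y (by simp [H.graph.self]))
    have hM0 : 0 ≤ M := (norm_nonneg _).trans (hM y y y (by simp [H.graph.self]))
    by_cases h0 : H.d y y' ≤ r
    · have := hM x y y' h0
      have : 0 ≤ max M M1 := hM0.trans (le_max_left _ _)
      linarith
    · obtain ⟨u, hu, huy⟩ := H.graph.between y y' r (by omega)
      have h1 := hM x y u (by omega)
      have h2 := hM1 x u y' (by omega)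
      have h3 := hM1 y u y' (by omega)
      have h4 := hC.cocycle x y u y'
      have e : C x y y' = C x y u + C x u y' - C y u y'
          + (C y u y' - C x u y' + C x y y' - C x y u) := by abel
      rw [e, h4, add_zero]
      have h5 := norm_sub_le (C x y u + C x u y') (C y u y')
      have h6 := norm_add_le (C x y u) (C x u y')
      have : 0 ≤ max M M1 := hM0.trans (le_max_left _ _)
      linarith

end IsBalanced

theorem exists_geometric_bound : ∃ s B : ℝ, 0 ≤ s ∧ s < 1 ∧ 0 ≤ B ∧
    ∀ t : ℕ, H.rate ^ (t / H.lev - 2) ≤ B * s ^ t := by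
  have hL := H.lev_pos
  -- The lower bound 1/2 makes σ positive, so that the truncated subtraction of 2 and the rounding
  -- in t / `lev` can be paid for by the factor 1 / σ³.
  set σ := max H.rate (1 / 2)
  have hσ0 : 0 < σ := lt_of_lt_of_le (by norm_num) (le_max_right _ _)
  have hσ1 : σ < 1 := max_lt H.rate_lt_one (by norm_num)
  have hL1 : (1 : ℝ) ≤ H.lev := by exact_mod_cast hL
  set s := 1 - (1 - σ) / H.lev
  have hfrac : (1 - σ) / H.lev ≤ 1 - σ := div_le_self (by linarith) hL1
  have hfrac0 : 0 < (1 - σ) / H.lev := div_pos (by linarith) (by linarith)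
  have hs0 : 0 < s := by simp only [s]; linarith
  have hs1 : s < 1 := by simp only [s]; linarith
  have hσs : σ ≤ s ^ H.lev := by
    have h := one_add_mul_le_pow (a := -((1 - σ) / H.lev)) (by linarith) H.lev
    have e : 1 + (H.lev : ℝ) * -((1 - σ) / H.lev) = σ := by field_simp; ring
    rw [e] at h
    simpa [s, sub_eq_add_neg] using h
  refine ⟨s, 1 / σ ^ 3, hs0.le, hs1, by positivity, fun t => ?_⟩
  rw [one_div, inv_mul_eq_div, le_div_iff₀ (by positivity)]
  have h1 : H.rate ^ (t / H.lev - 2) ≤ σ ^ (t / H.lev - 2) :=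
    pow_le_pow_left₀ H.rate_nonneg (le_max_left _ _) _
  have h2 : σ ^ (t / H.lev - 2) * σ ^ 3 ≤ σ ^ (t / H.lev + 1) := by
    rw [← pow_add]
    exact pow_le_pow_of_le_one hσ0.le hσ1.le (by omega)
  have h3 : σ ^ (t / H.lev + 1) ≤ s ^ (H.lev * (t / H.lev + 1)) := by
    rw [pow_mul]
    exact pow_le_pow_left₀ hσ0.le hσs _
  have h4 : s ^ (H.lev * (t / H.lev + 1)) ≤ s ^ t := by
    refine pow_le_pow_of_le_one hs0.le hs1.le ?_
    have := Nat.div_add_mod t H.lev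
    have := Nat.mod_lt t hL
    rw [mul_add, mul_one]
    omega
  calc _ ≤ σ ^ (t / H.lev - 2) * σ ^ 3 := mul_le_mul_of_nonneg_right h1 (by positivity)
    _ ≤ _ := h2.trans (h3.trans h4)

/-- Balanced cocycles are bounded on degenerate triangles. -/
theorem IsBalanced.exists_bound_degenerate {H : HypGroup Γ} {𝕜 : Type*} [RCLike 𝕜] {V : Type*}
    [NormedAddCommGroup V] [NormedSpace 𝕜 V] {C : Γ → Γ → Γ → V} (hC : H.IsBalanced 𝕜 C) :
    ∃ M : ℝ, ∀ x m y, H.d y m + H.d m x ≤ H.d y x + 2 * H.δ → ‖C x m y‖ ≤ M := by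
  have hδ := H.δ_pos
  have hL : H.lev = 200 * H.δ := rfl
  obtain ⟨M1, hM1⟩ := hC.exists_bound_short
  obtain ⟨M0, hM0⟩ := hC.exists_bound_of_dist_le (4 * H.lev)
  obtain ⟨s, B, hs0, hs1, hB, hsB⟩ := H.exists_geometric_bound
  have hM10 : 0 ≤ M1 := (norm_nonneg _).trans (hM1 1 1 1 (by simp [H.graph.self]))
  refine ⟨M0 + 4 * B * M1 * (1 / (1 - s)), fun x m y hm => ?_⟩
  -- The point z walks from y towards x until it is near m. The defect 6δ is preserved: it is the 5δ
  -- of one step plus one use of the four-point condition.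
  have key : ∀ t z, H.d z x = H.d m x + t → H.d y z + H.d z x ≤ H.d y x + 6 * H.δ →
      ‖C x m z‖ ≤ M0 + 4 * B * M1 * ∑ i ∈ Finset.range (t + 1), s ^ i := by
    intro t
    induction t using Nat.strong_induction_on with
    | _ t ih =>
      intro z hz hyz
      have hzm : H.d z m ≤ t + 7 * H.δ := by
        have h4 := H.four z m y x
        have s1 := H.graph.symm z y
        have s2 := H.graph.symm m y
        omega
      have hzm' : t ≤ H.d z m := by
        have := H.graph.tri z m x
        omega
      have hsum0 : 0 ≤ ∑ i ∈ Finset.range (t + 1), s ^ i :=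
        Finset.sum_nonneg fun i _ => pow_nonneg hs0 i
      by_cases ht : t ≤ 3 * H.lev
      · have h1 := hM0 x m z (by rw [H.graph.symm]; omega)
        have : 0 ≤ 4 * B * M1 * ∑ i ∈ Finset.range (t + 1), s ^ i := by positivity
        linarith
      · set S := H.ball z (100 * H.δ)
        have hzx : H.lev < H.d z x := by omega
        have hmean := hC.mean m z (by omega)
        -- Balance towards x removes the terms C(x, w, z), and balance towards m lets the kernel for
        -- m be subtracted in front of C(m, w, z). What remains is a difference of kernels whose
        -- targets both lie beyond most of [z, m].
        have e1 : C x m z = ∑ w ∈ S, (H.kernel z x w : 𝕜) • C x m w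
            - ∑ w ∈ S, ((H.kernel z x w - H.kernel z m w : ℝ) : 𝕜) • C m w z := by
          have h1 : ∑ w ∈ S, (H.kernel z x w : 𝕜) • C x m z
              = ∑ w ∈ S, ((H.kernel z x w : 𝕜) • C x m w + (H.kernel z x w : 𝕜) • C x w z
                - (H.kernel z x w : 𝕜) • C m w z) := by
            refine Finset.sum_congr rfl fun w _ => ?_
            rw [← smul_add, ← smul_sub]
            congr 1
            have h' : C x m z = C x m w + C x w z - C m w z
                + (C m w z - C x w z + C x m z - C x m w) := by abel
            rw [h', hC.cocycle x m w z, add_zero]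
          rw [IsBalanced.sum_kernel_smul hzx, Finset.sum_sub_distrib, Finset.sum_add_distrib,
            hC.mean x z hzx, add_zero] at h1
          rw [h1]
          simp only [RCLike.ofReal_sub, sub_smul, Finset.sum_sub_distrib]
          rw [hmean, sub_zero]
        have hfirst : ‖∑ w ∈ S, (H.kernel z x w : 𝕜) • C x m w‖
            ≤ M0 + 4 * B * M1 * ∑ i ∈ Finset.range t, s ^ i := by
          have hone : ∑ w ∈ S, H.kernel z x w
              * (M0 + 4 * B * M1 * ∑ i ∈ Finset.range t, s ^ i)
              = M0 + 4 * B * M1 * ∑ i ∈ Finset.range t, s ^ i := by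
            rw [← Finset.sum_mul, H.sum_kernel hzx.le, one_mul]
          rw [← hone]
          refine (norm_sum_le _ _).trans (Finset.sum_le_sum fun w _ => ?_)
          rw [norm_smul, RCLike.norm_ofReal, abs_of_nonneg (H.kernel_nonneg z x w)]
          by_cases h0 : H.kernel z x w = 0
          · rw [h0, zero_mul, zero_mul]
          · obtain ⟨h1, h2, h3⟩ := H.kernel_support hzx.le h0
            have h5 := H.graph.tri z w x
            obtain ⟨t', ht'⟩ := Nat.exists_eq_add_of_le (show H.d m x ≤ H.d w x by omega)
            refine mul_le_mul_of_nonneg_left ((ih t' (by omega) w ht' ?_).trans ?_)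
              (H.kernel_nonneg z x w)
            · have h4 := H.four w y z x
              have s1 := H.graph.symm w z
              have s2 := H.graph.symm y z
              have s3 := H.graph.symm y w
              omega
            · have hle : ∑ i ∈ Finset.range (t' + 1), s ^ i ≤ ∑ i ∈ Finset.range t, s ^ i :=
                Finset.sum_le_sum_of_subset_of_nonneg
                  (Finset.range_subset_range.2 (by omega)) fun i _ _ => pow_nonneg hs0 i
              have := mul_le_mul_of_nonneg_left hle (show 0 ≤ 4 * B * M1 by positivity)
              linarith
        have hsecond : ‖∑ w ∈ S, ((H.kernel z x w - H.kernel z m w : ℝ) : 𝕜) • C m w z‖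
            ≤ 4 * B * M1 * s ^ t := by
          have hdm := Nat.div_add_mod t H.lev
          have hdm2 := Nat.mod_lt t H.lev_pos
          have h3 : 3 ≤ t / H.lev := (Nat.le_div_iff_mul_le H.lev_pos).2 (by omega)
          obtain ⟨k, hk⟩ := Nat.exists_eq_add_of_le (show 2 ≤ t / H.lev by omega)
          have hkt : (k + 1) * H.lev + H.lev ≤ t := by
            calc (k + 1) * H.lev + H.lev = H.lev * (2 + k) := by ring
              _ ≤ t := by rw [← hk]; omega
          obtain ⟨v, hv, hvm⟩ := H.graph.between z m ((k + 1) * H.lev) (by omega)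
          have hvx := H.graph.tri v m x
          have hker := H.sum_abs_kernel_sub_le (y := z) (x := x) (x' := m) hv (by omega) (by omega)
            (by omega) (by omega)
          have hkB : H.rate ^ k ≤ B * s ^ t := by
            have := hsB t
            rwa [hk, Nat.add_sub_cancel_left] at this
          calc _ ≤ ∑ w ∈ S, |H.kernel z x w - H.kernel z m w| * M1 := by
                refine (norm_sum_le _ _).trans (Finset.sum_le_sum fun w hw => ?_)
                rw [norm_smul, RCLike.norm_ofReal]
                have h1 := H.mem_ball.1 hw
                have h2 := H.graph.symm z w
                exact mul_le_mul_of_nonneg_left (hM1 m w z (by omega)) (abs_nonneg _)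
            _ ≤ (H.rate ^ k * 4) * M1 := by
                rw [← Finset.sum_mul]
                exact mul_le_mul_of_nonneg_right hker hM10
            _ ≤ (B * s ^ t * 4) * M1 :=
                mul_le_mul_of_nonneg_right (mul_le_mul_of_nonneg_right hkB (by norm_num)) hM10
            _ = _ := by ring
        rw [e1, Finset.sum_range_succ, mul_add]
        have := norm_sub_le (∑ w ∈ S, (H.kernel z x w : 𝕜) • C x m w)
          (∑ w ∈ S, ((H.kernel z x w - H.kernel z m w : ℝ) : 𝕜) • C m w z)
        linarith
  by_cases hbase : H.d m x ≤ H.d y x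
  · obtain ⟨t, ht⟩ := Nat.exists_eq_add_of_le hbase
    refine (key t y ht (by simp [H.graph.self])).trans ?_
    have hgeom : ∑ i ∈ Finset.range (t + 1), s ^ i ≤ 1 / (1 - s) := by
      rw [le_div_iff₀ (by linarith), geom_sum_mul_neg]
      linarith [pow_nonneg hs0 (t + 1)]
    have := mul_le_mul_of_nonneg_left hgeom (show 0 ≤ 4 * B * M1 by positivity)
    linarith
  · refine (hM0 x m y (by rw [H.graph.symm]; omega)).trans ?_
    have : 0 ≤ 4 * B * M1 * (1 / (1 - s)) := by
      have : 0 < 1 - s := by linarith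
      positivity
    linarith

end HypGroup

/-! ### Alternation of cocycles in degree two -/

section Alternation

variable (𝕜 : Type*) [RCLike 𝕜] (Γ : Type*)
  (V : Type*) [NormedAddCommGroup V] [NormedSpace 𝕜 V]

/-- The cochain whose coboundary is the defect of alternation of a `2`-cocycle. -/
noncomputable def alternationDefect : Cochain Γ V 2 →L[𝕜] Cochain Γ V 1 :=
  ContinuousLinearMap.pi fun x =>
    (2⁻¹ : 𝕜) • (evalCochain 𝕜 ![x 0, x 1, x 0] + evalCochain 𝕜 ![x 1, x 1, x 1])

/-- The correction of a `2`-cocycle to an alternating one. -/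
noncomputable def alternation : Cochain Γ V 2 →L[𝕜] Cochain Γ V 2 :=
  ContinuousLinearMap.id 𝕜 _ -
    (⟨coboundary 𝕜 Γ V 1, continuous_coboundary 1⟩ : Cochain Γ V 1 →L[𝕜] Cochain Γ V 2).comp
      (alternationDefect 𝕜 Γ V)

variable {𝕜 Γ V}

theorem alternationDefect_apply (c : Cochain Γ V 2) (x y : Γ) :
    alternationDefect 𝕜 Γ V c ![x, y] = (2⁻¹ : 𝕜) • (c ![x, y, x] + c ![y, y, y]) := rfl

theorem alternation_eq (c : Cochain Γ V 2) :
    alternation 𝕜 Γ V c = c - coboundary 𝕜 Γ V 1 (alternationDefect 𝕜 Γ V c) := rfl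

variable [Group Γ] (ρ : Γ →* (V ≃ₗᵢ[𝕜] V)) {c : Cochain Γ V 2}

theorem alternationDefect_equivariant (hc : c ∈ cocycles ρ 2) :
    alternationDefect 𝕜 Γ V c ∈ equivariantCochains ρ 1 := by
  rw [mem_cocycles_two_iff] at hc
  rw [mem_equivariantCochains_one_iff]
  intro g x y
  simp only [alternationDefect_apply, hc.1, map_smul, map_add]

theorem alternation_mem_cocycles (hc : c ∈ cocycles ρ 2) :
    alternation 𝕜 Γ V c ∈ cocycles ρ 2 := by
  rw [alternation_eq]
  exact Submodule.sub_mem _ hc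
    ⟨coboundary_mem_equivariantCochains ρ (alternationDefect_equivariant ρ hc),
      LinearMap.mem_ker.2 (coboundary_coboundary _)⟩

theorem alternation_self (hc : c ∈ cocycles ρ 2) (x y : Γ) :
    alternation 𝕜 Γ V c ![x, y, y] = 0 := by
  rw [mem_cocycles_two_iff] at hc
  rw [alternation_eq, Pi.sub_apply, coboundary_one_apply]
  simp only [alternationDefect_apply]
  have h := hc.2 x y y y
  linear_combination (norm := module) (-1 : 𝕜) • h

/-- The defect of antisymmetry is a combination of the cocycle identities on five degenerate
tetrahedra. -/
theorem alternation_swap_right (hc : c ∈ cocycles ρ 2) (x y z : Γ) :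
    alternation 𝕜 Γ V c ![x, y, z] = - alternation 𝕜 Γ V c ![x, z, y] := by
  rw [mem_cocycles_two_iff] at hc
  rw [alternation_eq, Pi.sub_apply, Pi.sub_apply, coboundary_one_apply, coboundary_one_apply]
  simp only [alternationDefect_apply]
  have h1 := hc.2 x y z y
  have h2 := hc.2 x y y y
  have h3 := hc.2 y z y z
  have h4 := hc.2 y z z z
  have h5 := hc.2 y y y z
  linear_combination (norm := module) (-1 : 𝕜) • h1 + (-1 : 𝕜) • h2
    + (-2⁻¹ : 𝕜) • h3 + (-2⁻¹ : 𝕜) • h4 + (-2⁻¹ : 𝕜) • h5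

theorem alternation_swap_left (hc : c ∈ cocycles ρ 2) (x y z : Γ) :
    alternation 𝕜 Γ V c ![x, y, z] = - alternation 𝕜 Γ V c ![y, x, z] := by
  have h0 := ((mem_cocycles_two_iff ρ _).1 (alternation_mem_cocycles ρ hc)).2
  have h1 : ∀ x y, alternation 𝕜 Γ V c ![x, x, y] = 0 := fun x y => by
    have h := h0 x x x y
    rw [alternation_self ρ hc] at h
    simpa using h
  have h := h0 x y x z
  rw [alternation_swap_right ρ hc x y x, h1, h1] at h
  simpa [eq_neg_iff_add_eq_zero, add_comm] using h

end Alternation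

/-! ### The correction by the random walk -/

namespace HypGroup

variable {Γ : Type*} [Group Γ] (H : HypGroup Γ) (𝕜 : Type*) [RCLike 𝕜]
  (V : Type*) [NormedAddCommGroup V] [NormedSpace 𝕜 V]

/-- The mean over the walk from `y` to `x`, stopped after `n` steps, of the sum of a cochain over
the triangles that join the steps to `x`. -/
noncomputable def walk : ℕ → Γ → Γ → (Cochain Γ V 2 →L[𝕜] V)
  | 0, _, _ => 0
  | n + 1, x, y => if H.d y x ≤ H.lev then 0 else
      ∑ z ∈ H.ball y (100 * H.δ),
        (H.kernel y x z : 𝕜) • (walk n x z + evalCochain 𝕜 ![x, z, y])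

variable {V}

theorem walk_of_le {x y : Γ} (h : H.d y x ≤ H.lev) (n : ℕ) : H.walk 𝕜 V n x y = 0 := by
  cases n with
  | zero => rfl
  | succ n => simp [walk, h]

theorem dist_lt_of_kernel_ne_zero {x y z : Γ} (h : H.lev < H.d y x) (hz : H.kernel y x z ≠ 0) :
    H.d z x < H.d y x := by
  have h1 := H.kernel_support h.le hz
  have := H.δ_pos
  omega

/-- Each step decreases the distance to x, so d(y, x) steps are always enough and the recursion for
the unstopped walk holds exactly. -/
theorem walk_stable : ∀ (n m : ℕ) (x y : Γ), H.d y x ≤ n → H.d y x ≤ m →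
    H.walk 𝕜 V n x y = H.walk 𝕜 V m x y
  | 0, m, x, y, hn, _ => by rw [H.walk_of_le 𝕜 (by omega), H.walk_of_le 𝕜 (by omega)]
  | n + 1, 0, x, y, _, hm => by rw [H.walk_of_le 𝕜 (by omega), H.walk_of_le 𝕜 (by omega)]
  | n + 1, m + 1, x, y, hn, hm => by
    by_cases h : H.d y x ≤ H.lev
    · rw [H.walk_of_le 𝕜 h, H.walk_of_le 𝕜 h]
    · simp only [walk, h, if_false]
      refine Finset.sum_congr rfl fun z _ => ?_
      by_cases hz : H.kernel y x z = 0
      · simp [hz]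
      · have := H.dist_lt_of_kernel_ne_zero (by omega) hz
        rw [walk_stable n m x z (by omega) (by omega)]

variable (V) in
/-- The mean over the walk from `y` to `x` of the sum of a cochain over the triangles that join the
steps to `x`. -/
noncomputable def potential (x y : Γ) : Cochain Γ V 2 →L[𝕜] V := H.walk 𝕜 V (H.d y x) x y

theorem potential_of_le {x y : Γ} (h : H.d y x ≤ H.lev) : H.potential 𝕜 V x y = 0 :=
  H.walk_of_le 𝕜 h _

theorem potential_of_lt {x y : Γ} (h : H.lev < H.d y x) (c : Cochain Γ V 2) :
    H.potential 𝕜 V x y c = ∑ z ∈ H.ball y (100 * H.δ),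
      (H.kernel y x z : 𝕜) • (H.potential 𝕜 V x z c + c ![x, z, y]) := by
  obtain ⟨n, hn⟩ := Nat.exists_eq_succ_of_ne_zero (show H.d y x ≠ 0 by omega)
  rw [potential, hn]
  simp only [walk, h.not_ge, if_false]
  rw [_root_.sum_apply]
  refine Finset.sum_congr rfl fun z _ => ?_
  by_cases hz : H.kernel y x z = 0
  · simp [hz]
  · have := H.dist_lt_of_kernel_ne_zero h hz
    rw [H.walk_stable 𝕜 n (H.d z x) x z (by omega) le_rfl]
    rfl

variable {𝕜} (ρ : Γ →* (V ≃ₗᵢ[𝕜] V)) {c : Cochain Γ V 2}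

theorem potential_equivariant (hc : c ∈ cocycles ρ 2) (g x y : Γ) :
    H.potential 𝕜 V (g * x) (g * y) c = ρ g (H.potential 𝕜 V x y c) := by
  classical
  induction hn : H.d y x using Nat.strong_induction_on generalizing y with
  | _ n ih =>
    subst hn
    by_cases h : H.d y x ≤ H.lev
    · rw [H.potential_of_le 𝕜 h, H.potential_of_le 𝕜 (by rwa [H.inv])]
      simp
    · rw [H.potential_of_lt 𝕜 (x := x) (by omega),
        H.potential_of_lt 𝕜 (x := g * x) (by rw [H.inv]; omega), H.ball_mul,
        Finset.sum_image fun _ _ _ _ h => mul_left_cancel h, map_sum]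
      refine Finset.sum_congr rfl fun z _ => ?_
      rw [H.kernel_mul, map_smul, map_add, ((mem_cocycles_two_iff ρ c).1 hc).1]
      by_cases hz : H.kernel y x z = 0
      · simp [hz]
      · rw [ih _ (H.dist_lt_of_kernel_ne_zero (by omega) hz) z rfl]

/-- Subtracting the potential of an alternating cocycle balances it. -/
theorem isBalanced_potential (hc : c ∈ cocycles ρ 2) (h0 : ∀ x y, c ![x, y, y] = 0)
    (h1 : ∀ x y z, c ![x, y, z] = - c ![x, z, y]) :
    H.IsBalanced 𝕜 fun x y z => c ![x, y, z]
      + (H.potential 𝕜 V y z c - H.potential 𝕜 V x z c + H.potential 𝕜 V x y c) where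
  cocycle x y z t := by
    have := ((mem_cocycles_two_iff ρ c).1 hc).2 x y z t
    rw [← this]
    abel
  norm_mul g x y z := by
    simp only [H.potential_equivariant ρ hc, ((mem_cocycles_two_iff ρ c).1 hc).1, ← map_add,
      ← map_sub, LinearIsometryEquiv.norm_map]
  mean x y h := by
    have hz : ∀ z ∈ H.ball y (100 * H.δ), (H.kernel y x z : 𝕜) • (c ![x, z, y]
        + (H.potential 𝕜 V z y c - H.potential 𝕜 V x y c + H.potential 𝕜 V x z c))
        = (H.kernel y x z : 𝕜) • (H.potential 𝕜 V x z c + c ![x, z, y])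
          - (H.kernel y x z : 𝕜) • H.potential 𝕜 V x y c := fun z hz => by
      have h2 := H.mem_ball.1 hz
      have hL : H.lev = 200 * H.δ := rfl
      -- The potential across a single step vanishes because steps are shorter than `lev`; the mean
      -- is then exactly the recursion defining the potential.
      rw [H.potential_of_le 𝕜 (show H.d y z ≤ H.lev by omega), ← smul_sub]
      congr 1
      simp only [zero_apply]
      abel
    rw [Finset.sum_congr rfl hz, Finset.sum_sub_distrib, IsBalanced.sum_kernel_smul h,
      ← H.potential_of_lt 𝕜 h, sub_self]
  anti x y y' h := by
    rw [H.potential_of_le 𝕜 h, H.potential_of_le 𝕜 (by rwa [H.graph.symm]), h1 x y y']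
    simp only [zero_apply]
    abel
  self x y := by
    rw [H.potential_of_le 𝕜 (x := y) (y := y) (by simp [H.graph.self]), h0]
    simp

/-- A point near the three sides of a triangle. -/
theorem exists_center (x y z : Γ) : ∃ m, H.d x m + H.d m y ≤ H.d x y + 2 * H.δ ∧
    H.d x m + H.d m z ≤ H.d x z + 2 * H.δ ∧ H.d y m + H.d m z ≤ H.d y z + 2 * H.δ := by
  have hδ := H.δ_pos
  have h1 := H.graph.tri x y z
  have h2 := H.graph.tri x z y
  have h3 := H.graph.tri y x z
  have h4 := H.graph.symm z y
  have h5 := H.graph.symm x y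
  -- The distance from x is the Gromov product of y and z at x. Rounding it down costs at most 1 ≤
  -- δ, which is why the bound is 2δ.
  obtain ⟨m, hm, hmy⟩ := H.graph.between x y ((H.d x y + H.d x z - H.d y z) / 2) (by omega)
  have h6 := H.four m z x y
  have h7 := H.graph.symm m x
  have h8 := H.graph.symm m y
  have h9 := H.graph.symm x z
  refine ⟨m, ?_, ?_, ?_⟩ <;> omega

variable (𝕜 V) in
/-- The alternating part of the potential. -/
noncomputable def altPotential : Cochain Γ V 2 →L[𝕜] Cochain Γ V 1 :=
  ContinuousLinearMap.pi fun x =>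
    (2⁻¹ : 𝕜) • (H.potential 𝕜 V (x 0) (x 1) - H.potential 𝕜 V (x 1) (x 0))

theorem altPotential_apply (c : Cochain Γ V 2) (x y : Γ) : H.altPotential 𝕜 V c ![x, y]
    = (2⁻¹ : 𝕜) • (H.potential 𝕜 V x y c - H.potential 𝕜 V y x c) := rfl

theorem altPotential_equivariant (hc : c ∈ cocycles ρ 2) :
    H.altPotential 𝕜 V c ∈ equivariantCochains ρ 1 := by
  rw [mem_equivariantCochains_one_iff]
  intro g x y
  simp only [altPotential_apply, H.potential_equivariant ρ hc, map_smul, map_sub]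

/-- Every alternating cocycle is corrected to a bounded one. -/
theorem exists_norm_add_coboundary_le (hc : c ∈ cocycles ρ 2) (h0 : ∀ x y, c ![x, y, y] = 0)
    (h1 : ∀ x y z, c ![x, y, z] = - c ![x, z, y]) (h2 : ∀ x y z, c ![x, y, z] = - c ![y, x, z]) :
    ∃ M : ℝ, ∀ x y z,
      ‖c ![x, y, z] + coboundary 𝕜 Γ V 1 (H.altPotential 𝕜 V c) ![x, y, z]‖ ≤ M := by
  obtain ⟨M, hM⟩ := (H.isBalanced_potential ρ hc h0 h1).exists_bound_degenerate
  set C : Γ → Γ → Γ → V := fun x y z => c ![x, y, z]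
      + coboundary 𝕜 Γ V 1 (H.altPotential 𝕜 V c) ![x, y, z] with hC
  have hdeg : ∀ x m y, H.d x m + H.d m y ≤ H.d x y + 2 * H.δ → ‖C x m y‖ ≤ M := by
    intro x m y h
    have e1 := hM y m x h
    have e2 := hM x m y (by
      rw [H.graph.symm y m, H.graph.symm m x, H.graph.symm y x]; omega)
    -- Antisymmetrizing the potential amounts to taking half the difference of the balanced cocycle
    -- on (x, m, y) and on (y, m, x), and both are degenerate triangles.
    have e3 : C x m y = (2⁻¹ : 𝕜) • ((c ![x, m, y]
        + (H.potential 𝕜 V m y c - H.potential 𝕜 V x y c + H.potential 𝕜 V x m c))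
        - (c ![y, m, x]
        + (H.potential 𝕜 V m x c - H.potential 𝕜 V y x c + H.potential 𝕜 V y m c))) := by
      have : c ![y, m, x] = - c ![x, m, y] := by rw [h1 y, h2 y, h1 x, neg_neg]
      rw [this]
      simp only [hC, coboundary_one_apply, altPotential_apply]
      module
    rw [e3, norm_smul, norm_inv, RCLike.norm_ofNat]
    have := norm_sub_le (c ![x, m, y]
        + (H.potential 𝕜 V m y c - H.potential 𝕜 V x y c + H.potential 𝕜 V x m c)) (c ![y, m, x]
        + (H.potential 𝕜 V m x c - H.potential 𝕜 V y x c + H.potential 𝕜 V y m c))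
    linarith
  have hswap : ∀ x y z, C x y z = - C y x z := by
    intro x y z
    simp only [hC, coboundary_one_apply, altPotential_apply, h2 x y z]
    module
  have hcoc : ∀ m x y z, C x y z = C m y z - C m x z + C m x y := by
    intro m x y z
    have := ((mem_cocycles_two_iff ρ c).1 hc).2 m x y z
    simp only [hC, coboundary_one_apply]
    linear_combination (norm := module) (1 : 𝕜) • this
  refine ⟨3 * M, fun x y z => ?_⟩
  obtain ⟨m, m1, m2, m3⟩ := H.exists_center x y z
  have e1 := hdeg x m y m1
  have e2 := hdeg x m z m2
  have e3 := hdeg y m z m3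
  change ‖C x y z‖ ≤ _
  -- Coning from the center m splits the triangle into three, and antisymmetry moves m to the middle
  -- position, where these triangles are degenerate.
  rw [hcoc m, hswap m y z, hswap m x z, hswap m x y]
  have e4 := norm_add_le (-C y m z - -C x m z) (-C x m y)
  have e5 := norm_sub_le (-C y m z) (-C x m z)
  simp only [norm_neg] at e4 e5
  linarith

variable (𝕜 V) in
/-- The cochain whose coboundary corrects a cocycle to a bounded one. -/
noncomputable def boundingCochain : Cochain Γ V 2 →L[𝕜] Cochain Γ V 1 :=
  (H.altPotential 𝕜 V).comp (alternation 𝕜 Γ V) - alternationDefect 𝕜 Γ V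

theorem boundingCochain_apply (c : Cochain Γ V 2) : H.boundingCochain 𝕜 V c
    = H.altPotential 𝕜 V (alternation 𝕜 Γ V c) - alternationDefect 𝕜 Γ V c := rfl

theorem boundingCochain_equivariant (hc : c ∈ cocycles ρ 2) :
    H.boundingCochain 𝕜 V c ∈ equivariantCochains ρ 1 :=
  Submodule.sub_mem _ (H.altPotential_equivariant ρ (alternation_mem_cocycles ρ hc))
    (alternationDefect_equivariant ρ hc)

theorem add_coboundary_boundingCochain_mem_polCochains (hc : c ∈ cocycles ρ 2) (S : Set Γ) {N : ℝ}
    (hN : 0 ≤ N) :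
    c + coboundary 𝕜 Γ V 1 (H.boundingCochain 𝕜 V c) ∈ polCochains 𝕜 V S N 2 := by
  obtain ⟨M, hM⟩ := H.exists_norm_add_coboundary_le ρ (alternation_mem_cocycles ρ hc)
    (alternation_self ρ hc) (alternation_swap_right ρ hc) (alternation_swap_left ρ hc)
  have hM0 : 0 ≤ M := (norm_nonneg _).trans (hM 1 1 1)
  refine ⟨M, fun x => ?_⟩
  have e : c + coboundary 𝕜 Γ V 1 (H.boundingCochain 𝕜 V c) = alternation 𝕜 Γ V c
      + coboundary 𝕜 Γ V 1 (H.altPotential 𝕜 V (alternation 𝕜 Γ V c)) := by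
    rw [boundingCochain_apply, map_sub, alternation_eq]
    abel
  rw [e, ← vec_three_eta x]
  refine (hM _ _ _).trans (le_mul_of_one_le_right hM0 (Real.one_le_rpow ?_ hN))
  exact le_add_of_nonneg_right (Finset.sum_nonneg fun i _ => Nat.cast_nonneg _)

end HypGroup

/-- Linear Dehn function, linear filling inequality, four-point condition. -/
theorem FinitePresentation.exists_hypGroup {Γ : Type*} [Group Γ] (P : FinitePresentation Γ)
    {N : ℝ} (hN : 0 < N) (hN1 : N ≤ 1)
    (hP : GrowthLE (fun n => (P.dehn n : ℝ)) (fun t => t ^ N)) : Nonempty (HypGroup Γ) := by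
  obtain ⟨C, hC⟩ := hP.exists_le_linear hN hN1
  obtain ⟨K, hK⟩ := P.exists_linearFilling (C := C) fun n hn => by exact_mod_cast hC n hn
  obtain ⟨δ, hδ, h4⟩ := P.isGraphMetric_dist.exists_fourPoint hK
  exact ⟨⟨P.dist, P.isGraphMetric_dist, P.dist_mul_left, P.finite_ball, δ, hδ, h4⟩⟩

end QuantCoh

open QuantCoh

theorem mainTheorem9 {𝕜 : Type*} [RCLike 𝕜] {Γ : Type*} [Group Γ]
    {V : Type*} [NormedAddCommGroup V] [NormedSpace 𝕜 V] [CompleteSpace V]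
    (ρ : Γ →* (V ≃ₗᵢ[𝕜] V))
    (S : Set Γ) (hSfin : S.Finite) (hSgen : Subgroup.closure S = ⊤)
    (P : FinitePresentation Γ)
    (N : ℝ) (hN : 0 < N)
    (hDehn : GrowthLE (fun n => (P.dehn n : ℝ)) (fun t => t ^ N)) :
    ∃ e : PolCohomology ρ S (N + 1) N 2 ≃L[𝕜] Cohomology ρ 2,
      ∀ x, e x = comparisonMap ρ S (N + 1) N 2 x := by
  rcases le_total 1 N with h1 | h1
  · exact exists_comparison_equiv ρ hSfin hSgen hN.le (P.coneCochain 𝕜 V)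
      (fun c hc => coneCochain_equivariant ρ P hc)
      fun c hc => cone_mem_polCochains ρ P hSfin hSgen h1 hDehn hc
  -- Here the corrected cocycle is bounded, which is stronger than growth at most `N`.
  · obtain ⟨H⟩ := P.exists_hypGroup hN h1 hDehn
    exact exists_comparison_equiv ρ hSfin hSgen hN.le (H.boundingCochain 𝕜 V)
      (fun c hc => H.boundingCochain_equivariant ρ hc)
      fun c hc => H.add_coboundary_boundingCochain_mem_polCochains ρ hc S hN.le
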